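/- **Definition.** A set $\mathcal A\subseteq\mathbb Z$ is *polynomially regular* if for every integer $d\ge 1$ and all real $\alpha,\alpha_1>0$ there are $\beta_0>0$ and $C>0$ such that $$\Big|\sum_{\substack{n\in\mathcal A,\ |n|\le N\\ n\equiv r \bmod Q}} e^{2\pi i P(n)}\Big|\le C\,Q^{-1}N(\log N)^{-\alpha}$$ for all integers $N\ge 2$, all integers $1\le Q\le(\log N)^{\alpha_1}$, all $r\in\{1,\dots,Q\}$, all $\beta>\beta_0$, and all real polynomials $P$ of the form $P(x)=\frac aq x^d+\xi_{d-1}x^{d-1}+\dots+\xi_1x$, where $a,q$ are coprime integers with $1\le a\le q$ and $(\log N)^\beta\le q\le N^d(\log N)^{-\beta}$. **Theorem.** Let $\mathcal A_1,\dots,\mathcal A_k$ be polynomially regular subsets of $\mathbb Z$, let $d\in\mathbb N$ and $\alpha>0$. There is $\beta_0>0$ (depending only on $\mathcal A_1,\dots,\mathcal A_k$, $d$, $\alpha$), and for every real $K$ there is a constant $C>0$ (depending only on $\mathcal A_1,\dots,\mathcal A_k$, $d$, $\alpha$, $K$), such that the following holds. Let $\phi:\mathbb R^k\to\mathbb C$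 be differentiable with $$|\phi(x)|\le K,\qquad |\nabla\phi(x)|\le(1+\|x\|)^{-1}\qquad(x\in\mathbb R^k),$$ where $\|x\|$ is the Euclidean norm and $|\nabla\phi(x)|$ is the operator norm of the real derivative of $\phi$ at $x$. Let $\beta>\beta_0$, let $N\ge2$ be an integer, and let $$P(x)=\sum_{0<|\gamma|\le d}\xi_\gamma x^\gamma,\qquad \xi_\gamma\in\mathbb R,$$ be a polynomial on $\mathbb R^k$ such that for some multi-index $\gamma_0$ with $0<|\gamma_0|\le d$ and some coprime integers $a,q$ with $1\le a\le q$, $$\Big|\xi_{\gamma_0}-\frac aq\Big|\le\frac1{q^2},\qquad (\log N)^\beta\le q\le N^{|\gamma_0|}(\log N)^{-\beta}.$$ Then $$\sup_{\substack{\Omega\subseteq[-N,N]^k\\ \Omega\text{ convex}}}\Big|\sum_{n\in\mathcal A_1\times\dots\times\mathcal A_k}e^{2\pi iP(n)}\,\mathbf 1_\Omega(n)\,\phi(n)\Big|\le C\,N^k(\log N)^{-\alpha}.$$ -/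

import Mathlib

/-- The additive character `e(x) = exp(2πix)`. -/
noncomputable def addChar (x : ℝ) : ℂ :=
  Complex.exp (2 * (Real.pi : ℂ) * Complex.I * (x : ℂ))

/-- A set `A` of integers is polynomially regular if for every degree `d ≥ 1` and all `α, α₁ > 0`
there are `β₀, C > 0` such that for all `N ≥ 2`, all integers `1 ≤ Q ≤ (log N)^α₁`, all `β > β₀`,
all real polynomials `P(x) = (a/q) x^d + ⋯ + ξ₁ x` with `gcd(a, q) = 1`, `1 ≤ a ≤ q` and
`(log N)^β ≤ q ≤ N^d (log N)^(-β)`, and all `r ∈ {1, …, Q}`, the sum of `e(P(n))` over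
`n ∈ A ∩ [-N, N]`, `n ≡ r mod Q`, is at most `C Q⁻¹ N (log N)^(-α)` in absolute value. -/
def PolynomiallyRegular (A : Set ℤ) : Prop :=
  ∀ d : ℕ, 1 ≤ d → ∀ α : ℝ, 0 < α → ∀ α₁ : ℝ, 0 < α₁ →
    ∃ β₀ : ℝ, 0 < β₀ ∧ ∃ C : ℝ, 0 < C ∧
      ∀ N : ℕ, 2 ≤ N →
      ∀ Q : ℕ, 1 ≤ Q → (Q : ℝ) ≤ Real.log N ^ α₁ →
      ∀ β : ℝ, β₀ < β →
      ∀ (P : Polynomial ℝ) (a q : ℕ), Nat.Coprime a q → 1 ≤ a → a ≤ q →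
        P.natDegree ≤ d → P.coeff d = (a : ℝ) / (q : ℝ) → P.coeff 0 = 0 →
        Real.log N ^ β ≤ (q : ℝ) → (q : ℝ) ≤ (N : ℝ) ^ d * Real.log N ^ (-β) →
      ∀ r : ℕ, 1 ≤ r → r ≤ Q →
        ‖∑ n ∈ Finset.Icc (-(N : ℤ)) (N : ℤ),
            Set.indicator {m : ℤ | m ∈ A ∧ m ≡ (r : ℤ) [ZMOD (Q : ℤ)]}
              (fun m => addChar (P.eval (m : ℝ))) n‖
          ≤ C * (Q : ℝ)⁻¹ * (N : ℝ) * Real.log N ^ (-α)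

/-- The integer point `n ∈ ℤ^k` viewed as a point of the Euclidean space `ℝ^k`. -/
noncomputable def latticePoint {k : ℕ} (n : Fin k → ℤ) : EuclideanSpace ℝ (Fin k) :=
  WithLp.toLp 2 (fun i => (n i : ℝ))

/-- The sum of `e(P(n)) 1_Ω(n) φ(n)` over `n ∈ A₁ × ⋯ × A_k` with `n ∈ [-N, N]^k`.
It is the full sum over `A₁ × ⋯ × A_k` as soon as `Ω ⊆ [-N, N]^k`. -/
noncomputable def weightedExpSum {k : ℕ} (A : Fin k → Set ℤ) (P : MvPolynomial (Fin k) ℝ)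
    (Ω : Set (EuclideanSpace ℝ (Fin k))) (φ : EuclideanSpace ℝ (Fin k) → ℂ) (N : ℕ) : ℂ :=
  ∑ n ∈ Fintype.piFinset (fun _ : Fin k => Finset.Icc (-(N : ℤ)) (N : ℤ)),
    Set.indicator {m : Fin k → ℤ | (∀ i, m i ∈ A i) ∧ latticePoint m ∈ Ω}
      (fun m => addChar (MvPolynomial.eval (fun i => (m i : ℝ)) P) * φ (latticePoint m)) n

/-! The proof is a dichotomy between major and minor coefficients. A real x is major (`IsMajor`) if
qx lies within Z/X of an integer for some q ≤ Z; here Z is a power of log N, and X = N^i for a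
coefficient of degree i. By `not_isMajor_of_approx` the hypothesis on the coefficient of γ₀ makes it
minor.

One variable. Polynomial regularity treats a top coefficient equal to a/q. Dirichlet approximation
extends this to every minor top coefficient, and smoothing the endpoints passes from [-N, N] to
subintervals. If the top coefficient is major but a lower one is minor, split into residue classes
modulo the denominator of its approximation: on a class the phase of the top monomial is a constant
times a slowly varying factor, which partial summation removes, and the degree drops
(`PolynomiallyRegular.exists_bound_coeff`). Uniformity in the modulus Q and in the interval makes
this induction possible.

Several variables. Pick a variable that occurs in γ₀, with exponent i, and freeze the others at s.
The coefficient of the i-th power of that variable is a polynomial c(s), and the γ₀-coefficient of P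
is one of the coefficients of c. Slices with c(s) minor have small sums. If c(s) were major for too
many s, every coefficient of c would be major (`exists_isMajor_mvCoeff`), which is excluded; the
remaining slices are therefore few and are estimated trivially. The inverse statement comes from
pigeonhole and differencing of values.

Weight. By convexity a line parallel to an axis meets Ω in an interval, and the gradient bound gives
φ variation O(log N) along it. Partial summation thus costs one logarithm. -/

/-- `x` is within `Z / (q X)` of a rational number with denominator `q ≤ Z`. -/
def IsMajor (Z X x : ℝ) : Prop :=
  ∃ q : ℕ, 1 ≤ q ∧ (q : ℝ) ≤ Z ∧ ∃ m : ℤ, |q * x - m| ≤ Z / X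

theorem IsMajor.mono {Z Z' X X' x : ℝ} (h : IsMajor Z X x) (hZ : Z ≤ Z')
    (hXX : Z / X ≤ Z' / X') : IsMajor Z' X' x := by
  obtain ⟨q, h1, h2, m, h3⟩ := h
  exact ⟨q, h1, h2.trans hZ, m, h3.trans hXX⟩

/-! ### Rational approximation in one variable: from many values to the coefficients -/

/-- Pigeonhole in windows of length `w`. -/
theorem exists_close_pair (S : Finset ℤ) (N w : ℕ) (hw : 1 ≤ w)
    (hS : S ⊆ Finset.Icc (-(N : ℤ)) N) (hcard : 2 * N / w + 1 < S.card) :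
    ∃ a ∈ S, ∃ b ∈ S, a < b ∧ b - a < w ∧
      (S.card : ℤ) ≤ (b - a + 1) * ((2 * N / w + 1 : ℕ) : ℤ) := by
  set T := 2 * N / w + 1 with hT
  have hw' : (0 : ℤ) < w := by exact_mod_cast hw
  have hmaps : ∀ n ∈ S, (n + N) / (w : ℤ) ∈ Finset.Ico (0 : ℤ) T := by
    intro n hn
    have := Finset.mem_Icc.1 (hS hn)
    rw [Finset.mem_Ico]
    refine ⟨Int.ediv_nonneg (by omega) hw'.le, ?_⟩
    have h1 : (n + N) / (w : ℤ) ≤ (2 * N : ℤ) / w := Int.ediv_le_ediv hw' (by omega)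
    rw [hT]; push_cast
    exact Int.lt_add_one_iff.2 h1
  have hTpos : 0 < T := Nat.succ_pos _
  -- A window with more than (|S| - 1)/T points has at least |S|/T of them, and at least two because
  -- |S| > T. Its extreme points form the pair.
  obtain ⟨y, -, hy⟩ := Finset.exists_lt_card_fiber_of_mul_lt_card_of_maps_to
    (n := (S.card - 1) / T) hmaps (by
      have := Nat.mul_div_le (S.card - 1) T
      simp only [Int.card_Ico, sub_zero, Int.toNat_natCast]; omega)
  set F := S.filter (fun n => (n + N) / (w : ℤ) = y) with hF
  have h1 : 1 ≤ (S.card - 1) / T := (Nat.one_le_div_iff hTpos).2 (by omega)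
  have hne : F.Nonempty := Finset.card_pos.1 (by omega)
  have hsub : F ⊆ Finset.Icc (F.min' hne) (F.max' hne) := fun n hn =>
    Finset.mem_Icc.2 ⟨F.min'_le n hn, F.le_max' n hn⟩
  have hc := Finset.card_le_card hsub
  rw [Int.card_Icc] at hc
  have ha := Finset.mem_filter.1 (F.min'_mem hne)
  have hb := Finset.mem_filter.1 (F.max'_mem hne)
  have hfc : S.card ≤ F.card * T := by
    have h2 : S.card - 1 < T * ((S.card - 1) / T + 1) := by
      have := Nat.lt_mul_div_succ (S.card - 1) hTpos
      simpa using this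
    calc S.card ≤ T * ((S.card - 1) / T + 1) := by omega
      _ ≤ T * F.card := Nat.mul_le_mul_left _ hy
      _ = _ := mul_comm _ _
  refine ⟨_, ha.1, _, hb.1, by omega, ?_, ?_⟩
  · have e1 := Int.emod_add_mul_ediv (F.min' hne + N) w
    have e2 := Int.emod_add_mul_ediv (F.max' hne + N) w
    rw [ha.2] at e1
    rw [hb.2] at e2
    have := Int.emod_lt_of_pos (F.max' hne + N) hw'
    have := Int.emod_nonneg (F.min' hne + N) hw'.ne'
    omega
  · have : (F.card : ℤ) ≤ F.max' hne - F.min' hne + 1 := by omega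
    calc (S.card : ℤ) ≤ F.card * T := by exact_mod_cast hfc
      _ ≤ _ := by gcongr

/-- Pigeonhole on the denominators. -/
theorem exists_common_denominator {ι : Type*} {S : Finset ι} {Z X : ℝ}
    {f : ι → ℝ} (hf : ∀ n ∈ S, IsMajor Z X (f n)) (hZ : 1 ≤ Z) :
    ∃ q : ℕ, 1 ≤ q ∧ (q : ℝ) ≤ Z ∧ ∃ S' ⊆ S, (S.card : ℝ) ≤ Z * S'.card ∧
      ∀ n ∈ S', ∃ m : ℤ, |q * f n - m| ≤ Z / X := by
  classical
  rcases S.eq_empty_or_nonempty with rfl | hne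
  · exact ⟨1, le_rfl, by simpa using hZ, ∅, by simp, by simp, by simp⟩
  choose! q hq1 hq2 hq3 using hf
  have hmaps : ∀ n ∈ S, q n ∈ Finset.Icc 1 ⌊Z⌋₊ := fun n hn =>
    Finset.mem_Icc.2 ⟨hq1 n hn, Nat.le_floor (hq2 n hn)⟩
  obtain ⟨n0, hn0⟩ := hne
  have hpos : 0 < ⌊Z⌋₊ := Nat.floor_pos.2 hZ
  have hcard : (Finset.Icc 1 ⌊Z⌋₊).card • ((S.card : ℝ) / ⌊Z⌋₊) ≤ S.card := by
    have : (0 : ℝ) < ⌊Z⌋₊ := by exact_mod_cast hpos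
    simp only [Nat.card_Icc, add_tsub_cancel_right, nsmul_eq_mul]
    rw [mul_div_cancel₀ _ this.ne']
  obtain ⟨y, hy, hyc⟩ := Finset.exists_le_card_fiber_of_nsmul_le_card_of_maps_to hmaps
    ⟨_, hmaps n0 hn0⟩ hcard
  rw [Finset.mem_Icc] at hy
  refine ⟨y, hy.1, (Nat.cast_le.2 hy.2).trans (Nat.floor_le (by linarith)),
    S.filter (fun n => q n = y), Finset.filter_subset _ _, ?_, fun n hn => ?_⟩
  · have h0 : (0 : ℝ) < ⌊Z⌋₊ := by exact_mod_cast hpos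
    rw [div_le_iff₀ h0] at hyc
    refine hyc.trans ?_
    rw [mul_comm]
    gcongr
    exact Nat.floor_le (by linarith)
  · obtain ⟨h1, h2⟩ := Finset.mem_filter.1 hn
    rw [← h2]
    exact hq3 n h1

theorem nat_div_le_real (a b : ℕ) : ((a / b : ℕ) : ℝ) ≤ (a : ℝ) / b := Nat.cast_div_le

/-- Since Z ≥ 2, a numerical constant is absorbed into a power of Z. This is how every constant
below disappears into an exponent. -/
theorem const_mul_pow_le {Z c : ℝ} (hZ : 2 ≤ Z) (m k n : ℕ) (hc : c ≤ 2 ^ m) (h : m + k ≤ n) :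
    c * Z ^ k ≤ Z ^ n := by
  have hZ0 : 0 ≤ Z := by linarith
  calc c * Z ^ k ≤ Z ^ m * Z ^ k := by
        gcongr
        exact hc.trans (by gcongr)
    _ = Z ^ (m + k) := by rw [pow_add]
    _ ≤ Z ^ n := pow_le_pow_right₀ (by linarith) h

/-- If a linear function is often near rationals with small denominators, so is its slope. -/
theorem isMajor_slope {Z X c x : ℝ} {N : ℕ} {S : Finset ℤ} (hZ : 2 ≤ Z) (hN : Z ^ 18 ≤ N)
    (hX : (N : ℝ) ≤ X) (hS : S ⊆ Finset.Icc (-(N : ℤ)) N) (hcard : (N : ℝ) / Z ≤ S.card)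
    (hf : ∀ n ∈ S, IsMajor Z X (c + x * n)) : IsMajor (Z ^ 18) (X * N) x := by
  have hZ0 : 0 < Z := by linarith
  have hZ1 : 1 ≤ Z := by linarith
  have hN0 : (0 : ℝ) < N := lt_of_lt_of_le (by positivity) hN
  have hX0 : 0 < X := hN0.trans_le hX
  obtain ⟨q, hq1, hq2, S', hSS, hSc, hq⟩ := exists_common_denominator hf hZ1
  have hS' := hSS.trans hS
  have hq0 : (0 : ℝ) < q := by exact_mod_cast hq1
  have hc' : (N : ℝ) ≤ Z ^ 2 * S'.card := by
    rw [div_le_iff₀ hZ0] at hcard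
    nlinarith
  have hdiff : ∀ a ∈ S', ∀ b ∈ S', ∃ m : ℤ, |q * x * (b - a) - m| ≤ 2 * Z / X := by
    intro a ha b hb
    obtain ⟨m, hm⟩ := hq a ha
    obtain ⟨m', hm'⟩ := hq b hb
    refine ⟨m' - m, ?_⟩
    rw [abs_le] at *
    push_cast
    have : 2 * Z / X = Z / X + Z / X := by ring
    constructor <;> nlinarith
  -- a pair at bounded distance
  have hw1 : 1 ≤ ⌈8 * Z ^ 2⌉₊ := Nat.one_le_iff_ne_zero.2 (by
    rw [Ne, Nat.ceil_eq_zero]; push Not; positivity)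
  obtain ⟨a, ha, b, hb, hab, habw, -⟩ := exists_close_pair S' N ⌈8 * Z ^ 2⌉₊ hw1 hS' (by
    rw [← Nat.cast_lt (α := ℝ)]
    push_cast
    have h1 := nat_div_le_real (2 * N) ⌈8 * Z ^ 2⌉₊
    have h2 : ((2 * N : ℕ) : ℝ) / ⌈8 * Z ^ 2⌉₊ ≤ (2 * N : ℕ) / (8 * Z ^ 2) := by
      gcongr
      exact Nat.le_ceil _
    have h3 : ((2 * N : ℕ) : ℝ) / (8 * Z ^ 2) = N / Z ^ 2 / 4 := by push_cast; field_simp; norm_num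
    have h4 : (N : ℝ) / Z ^ 2 ≤ S'.card := by
      rw [div_le_iff₀ (by positivity)]; linarith
    have h5 : 2 ≤ (N : ℝ) / Z ^ 2 := by
      rw [le_div_iff₀ (by positivity)]
      exact (const_mul_pow_le hZ 1 2 18 (by norm_num) (by norm_num)).trans hN
    linarith)
  have hh1 : (1 : ℝ) ≤ b - a := by
    have : a + 1 ≤ b := hab
    have : ((a + 1 : ℤ) : ℝ) ≤ b := by exact_mod_cast this
    push_cast at this; linarith
  have hh2 : (b - a : ℝ) ≤ 9 * Z ^ 2 := by
    have h1 : ((b - a : ℤ) : ℝ) < (⌈8 * Z ^ 2⌉₊ : ℤ) := by exact_mod_cast habw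
    push_cast at h1
    have h2 := Nat.ceil_lt_add_one (show 0 ≤ 8 * Z ^ 2 by positivity)
    nlinarith
  obtain ⟨m, hm⟩ := hdiff a ha b hb
  -- a pair at distance comparable to `N`
  have hv : 2 ≤ (N : ℝ) / (16 * Z) := by
    rw [le_div_iff₀ (by positivity)]
    calc 2 * (16 * Z) = 2 ^ 5 * Z ^ 1 := by ring
      _ ≤ _ := (const_mul_pow_le hZ 5 1 18 le_rfl (by norm_num)).trans hN
  set w := ⌊(N : ℝ) / (16 * Z)⌋₊ with hw
  have hw2 : (N : ℝ) / (32 * Z) ≤ w := by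
    have h1 := Nat.lt_floor_add_one ((N : ℝ) / (16 * Z))
    have h2 : (N : ℝ) / (32 * Z) = N / (16 * Z) / 2 := by field_simp; norm_num
    rw [← hw] at h1
    linarith
  have hw0 : (0 : ℝ) < w := lt_of_lt_of_le (by positivity) hw2
  have hT : ((2 * N / w + 1 : ℕ) : ℝ) ≤ 65 * Z := by
    push_cast
    have h1 := nat_div_le_real (2 * N) w
    have h2 : ((2 * N : ℕ) : ℝ) / w ≤ 64 * Z := by
      rw [div_le_iff₀ hw0]
      push_cast
      calc (2 * N : ℝ) = 64 * Z * (N / (32 * Z)) := by field_simp; norm_num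
        _ ≤ _ := by gcongr
    linarith
  obtain ⟨a', ha', b', hb', hab', habw', hcab⟩ := exists_close_pair S' N w
    (by exact_mod_cast hw0) hS' (by
      rw [← Nat.cast_lt (α := ℝ)]
      refine hT.trans_lt (lt_of_mul_lt_mul_left (lt_of_lt_of_le ?_ hc') (by positivity : 0 ≤ Z ^ 2))
      calc Z ^ 2 * (65 * Z) < 2 ^ 7 * Z ^ 3 := by nlinarith [pow_pos hZ0 3]
        _ ≤ _ := (const_mul_pow_le hZ 7 3 18 le_rfl (by norm_num)).trans hN)
  have hk1 : (1 : ℝ) ≤ b' - a' := by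
    have : a' + 1 ≤ b' := hab'
    have : ((a' + 1 : ℤ) : ℝ) ≤ b' := by exact_mod_cast this
    push_cast at this; linarith
  have hk2 : (b' - a' : ℝ) ≤ N / (16 * Z) := by
    have h1 : ((b' - a' : ℤ) : ℝ) < (w : ℤ) := by exact_mod_cast habw'
    push_cast at h1
    have h2 := Nat.floor_le (show 0 ≤ (N : ℝ) / (16 * Z) by positivity)
    linarith
  have hk3 : (N : ℝ) ≤ 130 * Z ^ 3 * (b' - a') := by
    have h1 : (S'.card : ℝ) ≤ (b' - a' + 1) * (2 * N / w + 1 : ℕ) := by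
      generalize 2 * N / w + 1 = T at hcab
      exact_mod_cast hcab
    calc (N : ℝ) ≤ Z ^ 2 * S'.card := hc'
      _ ≤ Z ^ 2 * ((b' - a' + 1) * (2 * N / w + 1 : ℕ)) := by gcongr
      _ ≤ Z ^ 2 * ((2 * (b' - a')) * (65 * Z)) := by gcongr; linarith
      _ = _ := by ring
  obtain ⟨m', hm'⟩ := hdiff a' ha' b' hb'
  -- The short pair makes q(b - a)x close to the integer m, with error y = O(Z/X). The long pair is
  -- there to gain the further factor 1/N: y(b' - a') is close to the integer D, and it is also
  -- below 1/8, which forces D = 0. Dividing by b' - a', of order at least N/Z³, gives the error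
  -- claimed.
  set y := q * x * (b - a) - m with hy
  set D : ℤ := (b - a) * m' - m * (b' - a') with hD
  have e1 : |y * (b' - a') - D| ≤ 2 * Z / X * (9 * Z ^ 2) := by
    have : y * (b' - a') - D = (q * x * (b' - a') - m') * (b - a) := by
      rw [hy, hD]; push_cast; ring
    rw [this, abs_mul, abs_of_nonneg (show (0 : ℝ) ≤ b - a by linarith)]
    gcongr
  have e2 : 2 * Z / X * (9 * Z ^ 2) ≤ 1 / 4 := by
    calc 2 * Z / X * (9 * Z ^ 2) = 18 * Z ^ 3 / X := by ring
      _ ≤ 18 * Z ^ 3 / N := by gcongr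
      _ ≤ 1 / 4 := by
        rw [div_le_iff₀ hN0]
        have : 72 * Z ^ 3 ≤ N :=
          (const_mul_pow_le hZ 7 3 18 (by norm_num) (by norm_num)).trans hN
        linarith
  have e3 : |y * (b' - a')| ≤ 1 / 8 := by
    rw [abs_mul, abs_of_nonneg (show (0 : ℝ) ≤ b' - a' by linarith)]
    calc |y| * (b' - a') ≤ 2 * Z / N * (N / (16 * Z)) := by
          gcongr
          exact hm.trans (by gcongr)
      _ = 1 / 8 := by field_simp; norm_num
  have hD0 : D = 0 := by
    have : |(D : ℝ)| < 1 := by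
      rw [abs_le] at *
      rw [abs_lt]
      constructor <;> linarith
    exact Int.abs_lt_one_iff.1 (by exact_mod_cast this)
  rw [hD0, Int.cast_zero, sub_zero, abs_mul,
    abs_of_nonneg (show (0 : ℝ) ≤ b' - a' by linarith)] at e1
  refine ⟨q * (b - a).toNat, ?_, ?_, m, ?_⟩
  · have : 1 ≤ (b - a).toNat := by omega
    exact Nat.mul_pos hq1 this
  all_goals
    have hcast : (((b - a).toNat : ℕ) : ℝ) = b - a := by
      have : (((b - a).toNat : ℕ) : ℤ) = b - a := Int.toNat_of_nonneg (by omega)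
      exact_mod_cast this
    push_cast
    rw [hcast]
  · calc (q : ℝ) * (b - a) ≤ Z * (9 * Z ^ 2) := by gcongr
      _ = 9 * Z ^ 3 := by ring
      _ ≤ _ := const_mul_pow_le hZ 4 3 18 (by norm_num) (by norm_num)
  · have : (q * (b - a) * x - m : ℝ) = y := by rw [hy]; ring
    rw [this, le_div_iff₀ (by positivity)]
    calc |y| * (X * N) ≤ |y| * (X * (130 * Z ^ 3 * (b' - a'))) := by gcongr
      _ = |y| * (b' - a') * (X * (130 * Z ^ 3)) := by ring
      _ ≤ 2 * Z / X * (9 * Z ^ 2) * (X * (130 * Z ^ 3)) := by gcongr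
      _ = 2340 * Z ^ 6 := by field_simp; norm_num
      _ ≤ _ := const_mul_pow_le hZ 12 6 18 (by norm_num) (by norm_num)

/-- Rich fibres contribute at most M each, poor ones less than δ each. It serves to bound the number
of rich fibres from below. -/
theorem card_le_rich_fibers {α β : Type*} [DecidableEq β] (S : Finset α) (T : Finset β)
    (g : α → β) (hg : ∀ a ∈ S, g a ∈ T) {M δ : ℝ} (hδ : 0 ≤ δ)
    (hM : ∀ t ∈ T, ((S.filter (fun a => g a = t)).card : ℝ) ≤ M) :
    (S.card : ℝ) ≤
      ((T.filter (fun t => δ ≤ ((S.filter (fun a => g a = t)).card : ℝ))).card : ℝ) * M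
        + T.card * δ := by
  rw [Finset.card_eq_sum_card_fiberwise hg]
  push_cast
  rw [← Finset.sum_filter_add_sum_filter_not T
    (fun t => δ ≤ ((S.filter (fun a => g a = t)).card : ℝ))]
  refine add_le_add ?_ ?_
  · rw [← nsmul_eq_mul]
    exact Finset.sum_le_card_nsmul _ _ _ fun t ht => hM t (Finset.mem_filter.1 ht).1
  · refine (Finset.sum_le_card_nsmul _ _ δ fun t ht => ?_).trans ?_
    · exact (not_le.1 (Finset.mem_filter.1 ht).2).le
    · rw [nsmul_eq_mul]
      gcongr
      exact Finset.filter_subset _ _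

theorem IsMajor.of_natCast_mul {Z X x : ℝ} {k : ℕ} (hk : 1 ≤ k) (hX : 0 < X)
    (h : IsMajor Z X (k * x)) : IsMajor (k * Z) X x := by
  obtain ⟨q, h1, h2, m, h3⟩ := h
  have hk' : (1 : ℝ) ≤ k := by exact_mod_cast hk
  have hq : (1 : ℝ) ≤ q := by exact_mod_cast h1
  refine ⟨q * k, Nat.mul_pos h1 hk, ?_, m, ?_⟩
  · push_cast
    rw [mul_comm]
    gcongr
  · push_cast
    rw [mul_assoc]
    refine h3.trans ?_
    gcongr
    nlinarith

/-- For m ≥ d the m-th coefficient of the Taylor shift is a Hasse derivative of degree at most one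
evaluated at h, so only two terms survive. -/
theorem coeff_taylor_sub {P : Polynomial ℝ} {d : ℕ} (hP : P.natDegree ≤ d + 1) (h : ℝ) :
    (Polynomial.taylor h P - P).natDegree ≤ d ∧
      (Polynomial.taylor h P - P).coeff d = (d + 1) * P.coeff (d + 1) * h := by
  have hz : ∀ m, d + 1 < m → P.coeff m = 0 := fun m hm =>
    Polynomial.coeff_eq_zero_of_natDegree_lt (by omega)
  have hev : ∀ m, d ≤ m → (Polynomial.taylor h P).coeff m =
      P.coeff m + (m + 1) * P.coeff (m + 1) * h := by
    intro m hm
    rw [Polynomial.taylor_coeff, Polynomial.eval_eq_sum_range' (n := 2)]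
    · simp only [Polynomial.hasseDeriv_coeff, Finset.sum_range_succ, Finset.sum_range_zero,
        zero_add, Nat.choose_self, pow_zero, pow_one, add_comm 1 m, Nat.choose_succ_self_right]
      push_cast
      ring
    · have := Polynomial.natDegree_hasseDeriv_le P m
      omega
  constructor
  · rw [Polynomial.natDegree_le_iff_coeff_eq_zero]
    intro m hm
    rw [Polynomial.coeff_sub, hev m (by omega), hz (m + 1) (by omega)]
    ring
  · rw [Polynomial.coeff_sub, hev d le_rfl]
    ring

theorem card_Icc_le (N : ℕ) (hN : 1 ≤ N) : ((Finset.Icc (-(N : ℤ)) N).card : ℝ) ≤ 3 * N := by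
  have : (Finset.Icc (-(N : ℤ)) N).card ≤ 3 * N := by rw [Int.card_Icc]; omega
  exact_mod_cast this

/-- Many popular differences. -/
theorem card_popular_differences {S : Finset ℤ} {N : ℕ} {Z : ℝ} (hZ : 2 ≤ Z) (hN : 1 ≤ N)
    (hS : S ⊆ Finset.Icc (-(N : ℤ)) N) (hcard : (N : ℝ) / Z ^ 2 ≤ S.card) :
    (N : ℝ) / Z ^ 7 ≤ (((Finset.Icc (-((2 * N : ℕ) : ℤ)) (2 * N : ℕ)).filter (fun h =>
      (N : ℝ) / Z ^ 7 ≤ (S.filter (fun n => n + h ∈ S)).card)).card : ℝ) := by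
  have hZ0 : 0 < Z := by linarith
  have hN0 : (0 : ℝ) < N := by exact_mod_cast hN
  have hSc : (S.card : ℝ) ≤ 3 * N :=
    (Nat.cast_le.2 (Finset.card_le_card hS)).trans (card_Icc_le N hN)
  have hfib : ∀ h : ℤ, (((S ×ˢ S).filter (fun p => p.2 - p.1 = h)).card) ≤
      (S.filter (fun n => n + h ∈ S)).card := by
    intro h
    refine Finset.card_le_card_of_injOn (fun p => p.1) ?_ ?_
    · intro p hp
      simp only [Finset.coe_filter, Finset.mem_product, Set.mem_ofPred_eq] at hp ⊢
      refine ⟨hp.1.1, ?_⟩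
      rw [← hp.2]
      simpa using hp.1.2
    · intro p hp p' hp' heq
      simp only [Finset.coe_filter, Finset.mem_product, Set.mem_ofPred_eq] at hp hp' heq
      ext
      · exact heq
      · omega
  have key := card_le_rich_fibers (S ×ˢ S) (Finset.Icc (-((2 * N : ℕ) : ℤ)) (2 * N : ℕ))
    (fun p => p.2 - p.1) (by
      intro p hp
      rw [Finset.mem_product] at hp
      have h1 := Finset.mem_Icc.1 (hS hp.1)
      have h2 := Finset.mem_Icc.1 (hS hp.2)
      rw [Finset.mem_Icc]; push_cast; constructor <;> omega)
    (M := 3 * N) (δ := N / Z ^ 7) (by positivity) (fun h _ =>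
      (Nat.cast_le.2 ((hfib h).trans (Finset.card_filter_le _ _))).trans hSc)
  set G := (Finset.Icc (-((2 * N : ℕ) : ℤ)) (2 * N : ℕ)).filter (fun h =>
      (N : ℝ) / Z ^ 7 ≤ (S.filter (fun n => n + h ∈ S)).card) with hG
  have hle : (((Finset.Icc (-((2 * N : ℕ) : ℤ)) (2 * N : ℕ)).filter (fun h =>
      (N : ℝ) / Z ^ 7 ≤ (((S ×ˢ S).filter (fun p => p.2 - p.1 = h)).card : ℝ))).card : ℝ)
      ≤ G.card := by
    refine Nat.cast_le.2 (Finset.card_le_card fun h hh => ?_)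
    rw [Finset.mem_filter] at hh
    exact Finset.mem_filter.2 ⟨hh.1, hh.2.trans (Nat.cast_le.2 (hfib h))⟩
  have hcI : ((Finset.Icc (-((2 * N : ℕ) : ℤ)) (2 * N : ℕ)).card : ℝ) ≤ 5 * N := by
    have : (Finset.Icc (-((2 * N : ℕ) : ℤ)) (2 * N : ℕ)).card ≤ 5 * N := by
      rw [Int.card_Icc]; omega
    exact_mod_cast this
  rw [Finset.card_product, Nat.cast_mul] at key
  -- There are at least N²/Z⁴ pairs. As Z³ ≥ 8 = 3 + 5, this is at least 8N · N/Z⁷; poor differences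
  -- account for 5N · N/Z⁷, and a rich one for at most 3N.
  have h1 : (N : ℝ) / Z ^ 2 * (N / Z ^ 2) ≤ G.card * (3 * N) + 5 * N * (N / Z ^ 7) := by
    refine (mul_le_mul hcard hcard (by positivity) (by positivity)).trans (key.trans ?_)
    gcongr
  have h2 : (N : ℝ) / Z ^ 2 * (N / Z ^ 2) = N * (Z ^ 3 * (N / Z ^ 7)) := by
    field_simp
  have h3 : (8 : ℝ) ≤ Z ^ 3 := by
    calc (8 : ℝ) = 2 ^ 3 := by norm_num
      _ ≤ Z ^ 3 := by gcongr
  have h4 : (N : ℝ) * (8 * (N / Z ^ 7)) ≤ N * (Z ^ 3 * (N / Z ^ 7)) := by gcongr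
  have h5 : (N : ℝ) * (N / Z ^ 7) ≤ N * G.card := by linarith
  exact le_of_mul_le_mul_left h5 hN0

/-- If a polynomial is often near rationals with small denominators, so is its top coefficient. -/
theorem exists_isMajor_top (d : ℕ) : ∃ C : ℕ, ∀ (Z X : ℝ) (N : ℕ) (P : Polynomial ℝ)
    (S : Finset ℤ), 2 ≤ Z → Z ^ C ≤ N → (N : ℝ) ≤ X → S ⊆ Finset.Icc (-(N : ℤ)) N →
    (N : ℝ) / Z ≤ S.card → P.natDegree ≤ d → (∀ n ∈ S, IsMajor Z X (P.eval (n : ℝ))) →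
    IsMajor (Z ^ C) (X * N ^ d) (P.coeff d) := by
  induction d with
  | zero =>
    refine ⟨1, fun Z X N P S hZ hN hX hS hcard hP hf => ?_⟩
    rw [pow_one] at *
    have hN0 : (0 : ℝ) < N := by linarith
    have : (0 : ℝ) < S.card := lt_of_lt_of_le (by positivity) hcard
    obtain ⟨n, hn⟩ := Finset.card_pos.1 (Nat.cast_pos.1 this)
    have := hf n hn
    rw [Polynomial.eq_C_of_natDegree_le_zero hP, Polynomial.eval_C] at this
    simpa using this
  | succ d ih =>
    obtain ⟨C, ih⟩ := ih
    refine ⟨18 * (7 * C + 8) + (d + 1), fun Z X N P S hZ hN hX hS hcard hP hf => ?_⟩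
    have hZ0 : 0 < Z := by linarith
    have hZ1 : 1 ≤ Z := by linarith
    have hN0 : (0 : ℝ) < N := lt_of_lt_of_le (by positivity) hN
    have hN1 : 1 ≤ N := by exact_mod_cast hN0
    have hN1' : (1 : ℝ) ≤ N := by exact_mod_cast hN1
    have hX0 : 0 < X := hN0.trans_le hX
    have pw : ∀ m n : ℕ, m ≤ n → Z ^ m ≤ Z ^ n := fun m n h => pow_le_pow_right₀ hZ1 h
    obtain ⟨q, hq1, hq2, S', hSS, hSc, hq⟩ := exists_common_denominator hf hZ1
    have hc' : (N : ℝ) / Z ^ 2 ≤ S'.card := by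
      rw [div_le_iff₀ hZ0] at hcard
      rw [div_le_iff₀ (by positivity)]
      nlinarith
    have hG := card_popular_differences hZ hN1 (hSS.trans hS) hc'
    set G := (Finset.Icc (-((2 * N : ℕ) : ℤ)) (2 * N : ℕ)).filter (fun h =>
      (N : ℝ) / Z ^ 7 ≤ (S'.filter (fun n => n + h ∈ S')).card) with hGdef
    -- Weyl differencing on the level of values: for a popular h, P(n + h) - P(n) has degree at most
    -- d and is often near a rational of denominator q. By induction its top coefficient, which is
    -- linear in h, is major.
    have hmaj : ∀ h ∈ G, IsMajor (Z ^ (7 * C)) (X * N ^ d) ((d + 1) * P.coeff (d + 1) * h) := by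
      intro h hh
      obtain ⟨hd, hco⟩ := coeff_taylor_sub hP (h : ℝ)
      rw [← hco, pow_mul]
      refine ih (Z ^ 7) X N _ (S'.filter (fun n => n + h ∈ S')) ?_ ?_ hX
        ((Finset.filter_subset _ _).trans (hSS.trans hS)) (Finset.mem_filter.1 hh).2 hd ?_
      · calc (2 : ℝ) ≤ Z ^ 1 := by simpa using hZ
          _ ≤ Z ^ 7 := pw 1 7 (by norm_num)
      · rw [← pow_mul]
        exact (pw _ _ (by omega)).trans hN
      · intro n hn
        obtain ⟨hn1, hn2⟩ := Finset.mem_filter.1 hn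
        obtain ⟨m, hm⟩ := hq _ hn1
        obtain ⟨m', hm'⟩ := hq _ hn2
        refine ⟨q, hq1, hq2.trans (by simpa using pw 1 7 (by norm_num)), m' - m, ?_⟩
        rw [Polynomial.eval_sub, Polynomial.taylor_eval]
        push_cast at hm' ⊢
        have h2 : Z / X + Z / X ≤ Z ^ 7 / X := by
          rw [← add_div]
          gcongr
          calc Z + Z = 2 * Z ^ 1 := by ring
            _ ≤ _ := const_mul_pow_le hZ 1 1 7 (by norm_num) (by norm_num)
        rw [abs_le] at *
        constructor <;> nlinarith
    -- Differences run over [-2N, 2N], hence the length 2N and the doubled scale. The slope in h is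
    -- d + 1 times the top coefficient; the factor d + 1 goes into the denominator afterwards.
    have hsl := isMajor_slope (Z := Z ^ (7 * C + 8)) (X := 2 * (X * N ^ d)) (N := 2 * N)
      (c := 0) (x := (d + 1) * P.coeff (d + 1)) (S := G) ?_ ?_ ?_ (Finset.filter_subset _ _) ?_ ?_
    · have h1 : IsMajor ((Z ^ (7 * C + 8)) ^ 18) (X * N ^ (d + 1))
          (((d + 1 : ℕ) : ℝ) * P.coeff (d + 1)) := by
        push_cast
        refine hsl.mono le_rfl (div_le_div_of_nonneg_left (by positivity) (by positivity) ?_)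
        push_cast
        rw [pow_succ]
        have : 0 < X * N ^ d * N := by positivity
        nlinarith
      refine (h1.of_natCast_mul (by omega) (by positivity)).mono ?_ ?_
      all_goals
        have h2 : ((d + 1 : ℕ) : ℝ) * (Z ^ (7 * C + 8)) ^ 18 ≤ Z ^ (18 * (7 * C + 8) + (d + 1)) := by
          rw [← pow_mul]
          refine const_mul_pow_le hZ (d + 1) _ _ ?_ (by omega)
          exact_mod_cast (Nat.lt_two_pow_self (n := d + 1)).le
      · exact h2
      · gcongr
    · calc (2 : ℝ) ≤ Z ^ 1 := by simpa using hZ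
        _ ≤ _ := pw 1 _ (by omega)
    · rw [← pow_mul]
      push_cast
      have := (pw ((7 * C + 8) * 18) _ (by omega)).trans hN
      linarith
    · push_cast
      have : X * 1 ≤ X * N ^ d := by
        gcongr
        exact one_le_pow₀ hN1'
      linarith
    · refine le_trans ?_ hG
      push_cast
      rw [div_le_div_iff₀ (by positivity) (by positivity)]
      calc 2 * (N : ℝ) * Z ^ 7 = N * (2 * Z ^ 7) := by ring
        _ ≤ N * Z ^ (7 * C + 8) := by
          gcongr
          exact const_mul_pow_le hZ 1 7 _ (by norm_num) (by omega)
    · intro h hh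
      rw [zero_add]
      refine (hmaj h hh).mono (pw _ _ (by omega)) ?_
      rw [div_le_div_iff₀ (by positivity) (by positivity)]
      calc Z ^ (7 * C) * (2 * (X * N ^ d)) = 2 * Z ^ (7 * C) * (X * N ^ d) := by ring
        _ ≤ Z ^ (7 * C + 8) * (X * N ^ d) := by
          gcongr
          exact const_mul_pow_le hZ 1 _ _ (by norm_num) (by omega)

theorem isMajor_zero {Z X : ℝ} (hZ : 1 ≤ Z) (hX : 0 < X) : IsMajor Z X 0 :=
  ⟨1, le_rfl, by simpa using hZ, 0, by simp; positivity⟩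

/-- If a polynomial is often near rationals with small denominators, so are its coefficients. -/
theorem exists_isMajor_coeff (d : ℕ) : ∃ C : ℕ, ∀ (Z X : ℝ) (N : ℕ) (P : Polynomial ℝ)
    (S : Finset ℤ), 2 ≤ Z → Z ^ C ≤ N → (N : ℝ) ≤ X → S ⊆ Finset.Icc (-(N : ℤ)) N →
    (N : ℝ) / Z ≤ S.card → P.natDegree ≤ d → (∀ n ∈ S, IsMajor Z X (P.eval (n : ℝ))) →
    ∀ j, IsMajor (Z ^ C) (X * N ^ j) (P.coeff j) := by
  induction d with
  | zero =>
    obtain ⟨C, hC⟩ := exists_isMajor_top 0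
    refine ⟨C, fun Z X N P S hZ hN hX hS hcard hP hf j => ?_⟩
    rcases Nat.eq_zero_or_pos j with rfl | hj
    · exact hC Z X N P S hZ hN hX hS hcard hP hf
    · rw [Polynomial.coeff_eq_zero_of_natDegree_lt (by omega)]
      have hN0 : (0 : ℝ) < N := lt_of_lt_of_le (by positivity) hN
      have hX0 : 0 < X := hN0.trans_le hX
      exact isMajor_zero (one_le_pow₀ (by linarith)) (by positivity)
  | succ d ih =>
    obtain ⟨C, ih⟩ := ih
    obtain ⟨C₁, hC₁⟩ := exists_isMajor_top (d + 1)
    refine ⟨(C₁ + 2) * C + C₁, fun Z X N P S hZ hN hX hS hcard hP hf j => ?_⟩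
    have hZ0 : 0 < Z := by linarith
    have hZ1 : 1 ≤ Z := by linarith
    have hN0 : (0 : ℝ) < N := lt_of_lt_of_le (by positivity) hN
    have hX0 : 0 < X := hN0.trans_le hX
    have pw : ∀ m n : ℕ, m ≤ n → Z ^ m ≤ Z ^ n := fun m n h => pow_le_pow_right₀ hZ1 h
    have htop := hC₁ Z X N P S hZ ((pw _ _ (by omega)).trans hN) hX hS hcard hP hf
    by_cases hj : j = d + 1
    · subst hj
      refine htop.mono (pw _ _ (by omega)) ?_
      have := pw C₁ ((C₁ + 2) * C + C₁) (by omega)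
      gcongr
    have hco : P.coeff j = (P.erase (d + 1)).coeff j := (Polynomial.erase_ne P hj).symm
    have hdeg : (P.erase (d + 1)).natDegree ≤ d := by
      rw [Polynomial.natDegree_le_iff_coeff_eq_zero]
      intro m hm
      by_cases hmd : m = d + 1
      · rw [hmd, Polynomial.erase_same]
      · rw [Polynomial.erase_ne _ hmd]
        exact Polynomial.coeff_eq_zero_of_natDegree_lt (by omega)
    rw [hco]
    refine (ih (Z ^ (C₁ + 2)) X N (P.erase (d + 1)) S ?_ ?_ hX hS ?_ hdeg ?_ j).mono ?_ ?_
    · calc (2 : ℝ) ≤ Z ^ 1 := by simpa using hZ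
        _ ≤ _ := pw 1 _ (by omega)
    · rw [← pow_mul]
      exact (pw _ _ (by omega)).trans hN
    · refine le_trans ?_ hcard
      gcongr
      simpa using pw 1 (C₁ + 2) (by omega)
    · intro n hn
      obtain ⟨q₁, h1, h2, m₁, h3⟩ := htop
      obtain ⟨q, g1, g2, m, g3⟩ := hf n hn
      have hnN : |(n : ℝ)| ≤ N := by
        have := Finset.mem_Icc.1 (hS hn)
        rw [abs_le]
        exact ⟨by exact_mod_cast this.1, by exact_mod_cast this.2⟩
      -- With the product of the two denominators, the value of P and its top monomial are both near
      -- integers at integer points, hence so is their difference.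
      refine ⟨q * q₁, Nat.mul_pos g1 h1, ?_, q₁ * m - q * n ^ (d + 1) * m₁, ?_⟩
      · push_cast
        calc (q : ℝ) * q₁ ≤ Z * Z ^ C₁ := by gcongr
          _ = Z ^ (C₁ + 1) := by ring
          _ ≤ _ := pw _ _ (by omega)
      · have hev : P.eval (n : ℝ) = P.coeff (d + 1) * n ^ (d + 1) +
            (P.erase (d + 1)).eval (n : ℝ) := by
          conv_lhs => rw [← Polynomial.monomial_add_erase P (d + 1)]
          rw [Polynomial.eval_add, Polynomial.eval_monomial]
        have heq : ((q * q₁ : ℕ) : ℝ) * (P.erase (d + 1)).eval (n : ℝ)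
            - ((q₁ * m - q * n ^ (d + 1) * m₁ : ℤ) : ℝ)
            = q₁ * (q * P.eval (n : ℝ) - m)
              - q * n ^ (d + 1) * (q₁ * P.coeff (d + 1) - m₁) := by
          rw [hev]; push_cast; ring
        rw [heq]
        refine (abs_sub _ _).trans ?_
        rw [abs_mul, abs_mul, abs_mul, abs_pow, Nat.abs_cast, Nat.abs_cast]
        calc (q₁ : ℝ) * |q * P.eval (n : ℝ) - m|
              + q * |(n : ℝ)| ^ (d + 1) * |q₁ * P.coeff (d + 1) - m₁|
            ≤ Z ^ C₁ * (Z / X) + Z * (N : ℝ) ^ (d + 1) * (Z ^ C₁ / (X * N ^ (d + 1))) := by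
              gcongr
          _ = 2 * Z ^ (C₁ + 1) / X := by field_simp; ring
          _ ≤ Z ^ (C₁ + 2) / X := by
              gcongr
              exact const_mul_pow_le hZ 1 _ _ (by norm_num) (by omega)
    all_goals
      have := pw ((C₁ + 2) * C) ((C₁ + 2) * C + C₁) (by omega)
      rw [← pow_mul]
    · exact this
    · gcongr

/-! ### Rational approximation in several variables -/

/-- The box `[-N, N]^k` of integer points. -/
noncomputable def intBox (k N : ℕ) : Finset (Fin k → ℤ) :=
  Fintype.piFinset (fun _ : Fin k => Finset.Icc (-(N : ℤ)) (N : ℤ))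

theorem mem_intBox {k N : ℕ} {n : Fin k → ℤ} :
    n ∈ intBox k N ↔ ∀ i, n i ∈ Finset.Icc (-(N : ℤ)) (N : ℤ) := Fintype.mem_piFinset

theorem card_intBox_le (k : ℕ) {N : ℕ} (hN : 1 ≤ N) :
    ((intBox k N).card : ℝ) ≤ (3 * N) ^ k := by
  rw [intBox, Fintype.card_piFinset, Finset.prod_const, Finset.card_univ, Fintype.card_fin]
  push_cast
  gcongr
  exact card_Icc_le N hN

theorem eval_int_cons {k : ℕ} (P : MvPolynomial (Fin (k + 1)) ℝ) (n : Fin (k + 1) → ℤ) :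
    MvPolynomial.eval (fun i => (n i : ℝ)) P =
      ((MvPolynomial.finSuccEquiv ℝ k P).map
        (MvPolynomial.eval (fun i => (Fin.tail n i : ℝ)))).eval (n 0 : ℝ) := by
  rw [← MvPolynomial.eval_eq_eval_mv_eval']
  congr 1
  congr 1
  funext i
  refine Fin.cases ?_ (fun i => ?_) i <;> simp [Fin.tail]

/-- Induction on the number of variables. Many slices in the first variable are rich, and on each of
them the one-variable result makes the coefficients of that slice major. Such a coefficient is a
polynomial in the remaining variables with many major values, now at scale X N^i, so induction
applies to it. -/
theorem exists_isMajor_mvCoeff (k d : ℕ) : ∃ C : ℕ, ∀ (Z X : ℝ) (N : ℕ)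
    (P : MvPolynomial (Fin k) ℝ) (S : Finset (Fin k → ℤ)), 2 ≤ Z → Z ^ C ≤ N → (N : ℝ) ≤ X →
    S ⊆ intBox k N → (N : ℝ) ^ k / Z ≤ S.card → P.totalDegree ≤ d →
    (∀ n ∈ S, IsMajor Z X (MvPolynomial.eval (fun i => (n i : ℝ)) P)) →
    ∀ γ, IsMajor (Z ^ C) (X * N ^ γ.degree) (P.coeff γ) := by
  induction k with
  | zero =>
    refine ⟨1, fun Z X N P S hZ hN hX hS hcard hP hf γ => ?_⟩
    have : (0 : ℝ) < S.card := lt_of_lt_of_le (by positivity) hcard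
    obtain ⟨n, hn⟩ := Finset.card_pos.1 (Nat.cast_pos.1 this)
    have hev := hf n hn
    rw [MvPolynomial.eq_C_of_isEmpty P, MvPolynomial.eval_C] at hev
    rw [Subsingleton.elim γ 0]
    simpa using hev
  | succ k ih =>
    obtain ⟨C, ih⟩ := ih
    obtain ⟨C₁, hC₁⟩ := exists_isMajor_coeff d
    refine ⟨(2 * k + 4) * (C₁ + 1) * (C + 1), fun Z X N P S hZ hN hX hS hcard hP hf γ => ?_⟩
    have hZ0 : 0 < Z := by linarith
    have hZ1 : 1 ≤ Z := by linarith
    have hN0 : (0 : ℝ) < N := lt_of_lt_of_le (by positivity) hN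
    have hN1 : 1 ≤ N := by exact_mod_cast hN0
    have hN1' : (1 : ℝ) ≤ N := by exact_mod_cast hN1
    have hX0 : 0 < X := hN0.trans_le hX
    have pw : ∀ m n : ℕ, m ≤ n → Z ^ m ≤ Z ^ n := fun m n h => pow_le_pow_right₀ hZ1 h
    obtain ⟨A, hA⟩ : ∃ A, A = 2 * k + 4 := ⟨_, rfl⟩
    obtain ⟨B, hB⟩ : ∃ B, B = A * (C₁ + 1) := ⟨_, rfl⟩
    have hB1 : A * C₁ ≤ B := hB ▸ Nat.mul_le_mul_left _ (Nat.le_succ _)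
    have hB2 : A ≤ B := hB ▸ Nat.le_mul_of_pos_right _ (Nat.succ_pos _)
    have hB3 : B ≤ B * (C + 1) := Nat.le_mul_of_pos_right _ (Nat.succ_pos _)
    have hB4 : B * C ≤ B * (C + 1) := Nat.mul_le_mul_left _ (Nat.le_succ _)
    rw [← hA, ← hB] at hN ⊢
    have hmaps : ∀ n ∈ S, Fin.tail n ∈ intBox k N := fun n hn =>
      mem_intBox.2 fun i => mem_intBox.1 (hS hn) i.succ
    have hinj : ∀ s : Fin k → ℤ, Set.InjOn (fun n : Fin (k + 1) → ℤ => n 0)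
        (S.filter (fun n : Fin (k + 1) → ℤ => Fin.tail n = s)) := by
      intro s n hn n' hn' h0
      simp only [Finset.coe_filter, Set.mem_ofPred_eq] at hn hn'
      rw [← Fin.cons_self_tail n, ← Fin.cons_self_tail n', hn.2, hn'.2]
      exact congrArg (fun t : ℤ => (Fin.cons t s : Fin (k + 1) → ℤ)) h0
    have himg : ∀ s : Fin k → ℤ, (S.filter (fun n : Fin (k + 1) → ℤ => Fin.tail n = s)).image (fun n : Fin (k + 1) → ℤ => n 0) ⊆
        Finset.Icc (-(N : ℤ)) N := by
      intro s t ht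
      obtain ⟨n, hn, rfl⟩ := Finset.mem_image.1 ht
      exact mem_intBox.1 (hS (Finset.mem_filter.1 hn).1) 0
    have hfib : ∀ s ∈ intBox k N, ((S.filter (fun n : Fin (k + 1) → ℤ => Fin.tail n = s)).card : ℝ) ≤ 3 * N := by
      intro s _
      rw [← Finset.card_image_of_injOn (hinj s)]
      exact (Nat.cast_le.2 (Finset.card_le_card (himg s))).trans (card_Icc_le N hN1)
    have key := card_le_rich_fibers S (intBox k N) Fin.tail hmaps (M := 3 * N) (δ := N / Z ^ A)
      (by positivity) hfib
    set G := (intBox k N).filter (fun s =>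
      (N : ℝ) / Z ^ A ≤ ((S.filter (fun n : Fin (k + 1) → ℤ => Fin.tail n = s)).card : ℝ)) with hG
    have hGc : (N : ℝ) ^ k / Z ^ A ≤ G.card := by
      have h1 : (N : ℝ) ^ (k + 1) / Z ≤ G.card * (3 * N) + (3 * N) ^ k * (N / Z ^ A) := by
        refine hcard.trans (key.trans ?_)
        gcongr
        exact card_intBox_le k hN1
      have h2 : (3 * N : ℝ) ^ k * (N / Z ^ A) = 3 ^ k * (N * ((N : ℝ) ^ k / Z ^ A)) := by
        rw [mul_pow]; ring
      -- The exponent A = 2k + 4 comes from 3^k + 3 ≤ 2^(2k + 3): here 3^k pays for the poor slices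
      -- and 3 for the length of a rich one.
      have h3 : (3 ^ k + 3) * Z ^ 1 ≤ Z ^ A := by
        refine const_mul_pow_le hZ (2 * k + 3) 1 A ?_ (by omega)
        rw [pow_add, pow_mul]
        norm_num
        have h4 : (3 : ℝ) ^ k ≤ 4 ^ k := by gcongr; norm_num
        have h5 : (1 : ℝ) ≤ 4 ^ k := one_le_pow₀ (by norm_num)
        linarith
      have h4 : (3 ^ k + 3) * (N * ((N : ℝ) ^ k / Z ^ A)) ≤ (N : ℝ) ^ (k + 1) / Z := by
        have : (3 ^ k + 3) * (N * ((N : ℝ) ^ k / Z ^ A)) =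
            N ^ (k + 1) * ((3 ^ k + 3) * Z ^ 1) / Z ^ A / Z := by
          field_simp
          ring
        rw [this]
        gcongr
        rw [div_le_iff₀ (by positivity)]
        gcongr
      have h5 : (N : ℝ) * ((N : ℝ) ^ k / Z ^ A) ≤ N * G.card := by linarith
      exact le_of_mul_le_mul_left h5 hN0
    set i := γ 0 with hi
    have hco : P.coeff γ = ((MvPolynomial.finSuccEquiv ℝ k P).coeff i).coeff γ.tail := by
      rw [MvPolynomial.finSuccEquiv_coeff_coeff, hi, Finsupp.cons_tail]
    have hdeg : γ.degree = i + γ.tail.degree := by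
      rw [Finsupp.degree_eq_sum, Finsupp.degree_eq_sum, Fin.sum_univ_succ]
      rfl
    have hPd : (MvPolynomial.finSuccEquiv ℝ k P).natDegree ≤ d := by
      rw [MvPolynomial.natDegree_finSuccEquiv]
      exact (MvPolynomial.degreeOf_le_totalDegree P 0).trans hP
    have hmaj : ∀ s ∈ G, IsMajor (Z ^ B) (X * N ^ i)
        (MvPolynomial.eval (fun j => (s j : ℝ)) ((MvPolynomial.finSuccEquiv ℝ k P).coeff i)) := by
      intro s hs
      have h := hC₁ (Z ^ A) X N ((MvPolynomial.finSuccEquiv ℝ k P).map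
        (MvPolynomial.eval (fun j => (s j : ℝ))))
        ((S.filter (fun n : Fin (k + 1) → ℤ => Fin.tail n = s)).image (fun n : Fin (k + 1) → ℤ => n 0)) ?_ ?_ hX (himg s) ?_
        (Polynomial.natDegree_map_le.trans hPd) ?_ i
      · rw [Polynomial.coeff_map, ← pow_mul] at h
        have := pw _ _ hB1
        refine h.mono this ?_
        gcongr
      · calc (2 : ℝ) ≤ Z ^ 1 := by simpa using hZ
          _ ≤ _ := pw 1 _ (by omega)
      · rw [← pow_mul]
        exact (pw _ _ (hB1.trans hB3)).trans hN
      · rw [Finset.card_image_of_injOn (hinj s)]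
        exact (Finset.mem_filter.1 hs).2
      · intro t ht
        obtain ⟨n, hn, rfl⟩ := Finset.mem_image.1 ht
        obtain ⟨hn1, hn2⟩ := Finset.mem_filter.1 hn
        have := hf n hn1
        rw [eval_int_cons, hn2] at this
        refine this.mono (by simpa using pw 1 A (by omega)) ?_
        gcongr
        simpa using pw 1 A (by omega)
    have h := ih (Z ^ B) (X * N ^ i) N ((MvPolynomial.finSuccEquiv ℝ k P).coeff i) G
      ?_ ?_ ?_ (Finset.filter_subset _ _) ?_ ?_ hmaj γ.tail
    · rw [hco, hdeg, pow_add, ← mul_assoc]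
      rw [← pow_mul] at h
      have := pw _ _ hB4
      refine h.mono this ?_
      gcongr
    · calc (2 : ℝ) ≤ Z ^ 1 := by simpa using hZ
        _ ≤ _ := pw 1 _ (by omega)
    · rw [← pow_mul]
      exact (pw _ _ hB4).trans hN
    · calc (N : ℝ) ≤ X * 1 := by linarith
        _ ≤ _ := by
          gcongr
          exact one_le_pow₀ hN1'
    · refine le_trans ?_ hGc
      have := pw _ _ hB2
      gcongr
    · by_cases hz : (MvPolynomial.finSuccEquiv ℝ k P).coeff i = 0
      · rw [hz]; simp
      · have := MvPolynomial.totalDegree_coeff_finSuccEquiv_add_le P i hz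
        omega

/-! ### Additive characters and geometric sums -/

theorem addChar_add (x y : ℝ) : addChar (x + y) = addChar x * addChar y := by
  rw [addChar, addChar, addChar, ← Complex.exp_add]
  congr 1
  push_cast
  ring

theorem norm_addChar (x : ℝ) : ‖addChar x‖ = 1 := by
  have : 2 * (Real.pi : ℂ) * Complex.I * (x : ℂ) = ((2 * Real.pi * x : ℝ) : ℂ) * Complex.I := by
    push_cast; ring
  rw [addChar, this, Complex.norm_exp_ofReal_mul_I]

theorem addChar_intCast (n : ℤ) : addChar n = 1 := by
  rw [addChar, Complex.exp_eq_one_iff]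
  exact ⟨n, by push_cast; ring⟩

theorem addChar_add_intCast (x : ℝ) (n : ℤ) : addChar (x + n) = addChar x := by
  rw [addChar_add, addChar_intCast, mul_one]

theorem addChar_zero : addChar 0 = 1 := by simp [addChar]

theorem addChar_natCast_mul (n : ℕ) (x : ℝ) : addChar (n * x) = addChar x ^ n := by
  rw [addChar, addChar, ← Complex.exp_nat_mul]
  congr 1
  push_cast
  ring

theorem addChar_sub_one (x : ℝ) : ‖addChar x - 1‖ = 2 * |Real.sin (Real.pi * x)| := by
  have : 2 * (Real.pi : ℂ) * Complex.I * (x : ℂ) = Complex.I * ((2 * Real.pi * x : ℝ) : ℂ) := by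
    push_cast; ring
  rw [addChar, this, Complex.norm_exp_I_mul_ofReal_sub_one, norm_mul, Real.norm_eq_abs,
    Real.norm_eq_abs, abs_two, show 2 * Real.pi * x / 2 = Real.pi * x by ring]

theorem norm_addChar_sub_one_le (x : ℝ) : ‖addChar x - 1‖ ≤ 7 * |x| := by
  rw [addChar_sub_one]
  have h1 := Real.abs_sin_le_abs (x := Real.pi * x)
  rw [abs_mul, abs_of_pos Real.pi_pos] at h1
  have h2 : Real.pi * |x| ≤ 3.5 * |x| := by
    gcongr
    linarith [Real.pi_lt_d2]
  linarith

theorem norm_addChar_sub_le (x y : ℝ) : ‖addChar x - addChar y‖ ≤ 7 * |x - y| := by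
  have : addChar x - addChar y = addChar y * (addChar (x - y) - 1) := by
    rw [mul_sub, ← addChar_add, mul_one]
    congr 2
    ring
  rw [this, norm_mul, norm_addChar, one_mul]
  exact norm_addChar_sub_one_le _

theorem four_mul_le_norm_addChar_sub_one {x : ℝ} (hx : |x| ≤ 1 / 2) :
    4 * |x| ≤ ‖addChar x - 1‖ := by
  rw [addChar_sub_one]
  have h1 := Real.mul_abs_le_abs_sin (x := Real.pi * x) (by
    rw [abs_mul, abs_of_pos Real.pi_pos]
    nlinarith [Real.pi_pos])
  rw [abs_mul, abs_of_pos Real.pi_pos] at h1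
  have h2 : 2 / Real.pi * (Real.pi * |x|) = 2 * |x| := by
    field_simp
  linarith

/-- Geometric sums of additive characters. -/
theorem norm_sum_range_addChar_le (c x : ℝ) (n : ℕ) (hx : |x| ≤ 1 / 2) (hx0 : x ≠ 0) :
    ‖∑ j ∈ Finset.range n, addChar (c + j * x)‖ ≤ 1 / (2 * |x|) := by
  have h0 : 0 < |x| := abs_pos.2 hx0
  have h1 := four_mul_le_norm_addChar_sub_one hx
  have hne : addChar x ≠ 1 := fun h => by
    rw [h, sub_self, norm_zero] at h1; linarith
  simp_rw [addChar_add, addChar_natCast_mul]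
  rw [← Finset.mul_sum, geom_sum_eq hne, norm_mul, norm_addChar, one_mul, norm_div]
  rw [div_le_div_iff₀ (by linarith) (by positivity)]
  have h2 : ‖addChar x ^ n - 1‖ ≤ 2 := by
    refine (norm_sub_le _ _).trans ?_
    rw [norm_pow, norm_addChar, one_pow, norm_one]
    norm_num
  nlinarith

theorem sum_Ico_int_eq_sum_range {M : Type*} [AddCommMonoid M] (u : ℤ) (n : ℕ) (f : ℤ → M) :
    ∑ m ∈ Finset.Ico u (u + n), f m = ∑ j ∈ Finset.range n, f (u + j) := by
  induction n with
  | zero => simp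
  | succ n ih =>
    rw [Finset.sum_range_succ, ← ih]
    have : Finset.Ico u (u + (n + 1 : ℕ)) = insert (u + n) (Finset.Ico u (u + n)) := by
      ext m; simp only [Finset.mem_Ico, Finset.mem_insert]; push_cast; omega
    rw [this, Finset.sum_insert (by simp), add_comm]

theorem norm_sum_Icc_addChar_le (u v : ℤ) (x : ℝ) (hx : |x| ≤ 1 / 2) (hx0 : x ≠ 0) :
    ‖∑ m ∈ Finset.Icc u v, addChar (m * x)‖ ≤ 1 / (2 * |x|) := by
  have h0 : 0 < |x| := abs_pos.2 hx0
  rcases lt_or_ge v u with h | h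
  · rw [Finset.Icc_eq_empty (by omega), Finset.sum_empty, norm_zero]
    positivity
  · have : Finset.Icc u v = Finset.Ico u (u + ((v + 1 - u).toNat : ℕ)) := by
      ext m; simp only [Finset.mem_Ico, Finset.mem_Icc]; omega
    rw [this, sum_Ico_int_eq_sum_range]
    refine le_trans (le_of_eq ?_) (norm_sum_range_addChar_le (u * x) x (v + 1 - u).toNat hx hx0)
    congr 1
    refine Finset.sum_congr rfl fun j _ => ?_
    congr 1
    push_cast
    ring

/-- Orthogonality of the characters modulo `4 N + 1`. -/
theorem sum_addChar_orthogonality (N : ℕ) (t : ℤ) (ht : |t| < 4 * N + 1) :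
    ∑ b ∈ Finset.Icc (-(2 * N : ℤ)) (2 * N), addChar (b * (t / (4 * N + 1))) =
      if t = 0 then (4 * N + 1 : ℂ) else 0 := by
  split_ifs with h
  · subst h
    have hc : (Finset.Icc (-(2 * N : ℤ)) (2 * N)).card = 4 * N + 1 := by
      rw [Int.card_Icc]; omega
    simp only [Int.cast_zero, zero_div, mul_zero, addChar_zero, Finset.sum_const, hc,
      nsmul_eq_mul, mul_one]
    push_cast; ring
  · have hL : (0 : ℝ) < 4 * N + 1 := by positivity
    have : Finset.Icc (-(2 * N : ℤ)) (2 * N) =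
        Finset.Ico (-(2 * N : ℤ)) (-(2 * N : ℤ) + ((4 * N + 1 : ℕ) : ℤ)) := by
      ext m; simp only [Finset.mem_Ico, Finset.mem_Icc]; push_cast; omega
    rw [this, sum_Ico_int_eq_sum_range]
    have hne : addChar ((t : ℝ) / (4 * N + 1)) ≠ 1 := by
      rw [addChar, Ne, Complex.exp_eq_one_iff]
      rintro ⟨n, hn⟩
      have h2 : (2 * (Real.pi : ℂ) * Complex.I) ≠ 0 := Complex.two_pi_I_ne_zero
      rw [mul_comm (n : ℂ)] at hn
      have h3 := mul_left_cancel₀ h2 hn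
      have h4 : (t : ℝ) / (4 * N + 1) = n := by exact_mod_cast h3
      rw [div_eq_iff hL.ne'] at h4
      have h5 : t = n * (4 * N + 1) := by exact_mod_cast h4
      have h6 : n ≠ 0 := by rintro rfl; simp at h5; exact h h5
      have h7 : 1 ≤ |n| := Int.one_le_abs h6
      have h8 : |t| = |n| * (4 * N + 1) := by
        rw [h5, abs_mul]; congr 1
      nlinarith [Int.natCast_nonneg N]
    have : ∀ j : ℕ, addChar (((-(2 * N : ℤ) + j : ℤ) : ℝ) * (t / (4 * N + 1))) =
        addChar (-(2 * N) * (t / (4 * N + 1))) * addChar (t / (4 * N + 1)) ^ j := by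
      intro j
      rw [← addChar_natCast_mul, ← addChar_add]
      congr 1
      push_cast
      ring
    simp_rw [this]
    rw [← Finset.mul_sum, geom_sum_eq hne, ← addChar_natCast_mul]
    have : ((4 * N + 1 : ℕ) : ℝ) * (t / (4 * N + 1)) = t := by
      push_cast; field_simp
    rw [this, addChar_intCast, sub_self, zero_div, mul_zero]

/-! ### Summation by parts, and interval sums from twisted full sums -/

theorem sum_mul_Icc_eq (f w : ℤ → ℂ) (u v : ℤ) (huv : u ≤ v) :
    ∑ n ∈ Finset.Icc u v, f n * w n = (∑ n ∈ Finset.Icc u v, f n) * w v -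
      ∑ n ∈ Finset.Ico u v, (∑ m ∈ Finset.Icc u n, f m) * (w (n + 1) - w n) := by
  induction v, huv using Int.leInduction with
  | base => simp
  | succ v hv ih =>
    have h1 : Finset.Icc u (v + 1) = insert (v + 1) (Finset.Icc u v) := by
      ext m; simp only [Finset.mem_Icc, Finset.mem_insert]; omega
    have h2 : Finset.Ico u (v + 1) = insert v (Finset.Ico u v) := by
      ext m; simp only [Finset.mem_Ico, Finset.mem_insert]; omega
    have h3 : v + 1 ∉ Finset.Icc u v := by simp
    have h4 : v ∉ Finset.Ico u v := by simp
    rw [h1, h2, Finset.sum_insert h3, Finset.sum_insert h3, Finset.sum_insert h4, ih]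
    ring

/-- Summation by parts. -/
theorem norm_sum_mul_le {f w : ℤ → ℂ} {u v : ℤ} {M : ℝ} (huv : u ≤ v)
    (hM : ∀ t ∈ Finset.Icc u v, ‖∑ n ∈ Finset.Icc u t, f n‖ ≤ M) :
    ‖∑ n ∈ Finset.Icc u v, f n * w n‖ ≤
      M * (‖w v‖ + ∑ n ∈ Finset.Ico u v, ‖w (n + 1) - w n‖) := by
  rw [sum_mul_Icc_eq f w u v huv, mul_add, Finset.mul_sum]
  refine (norm_sub_le _ _).trans (add_le_add ?_ ?_)
  · rw [norm_mul]
    gcongr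
    exact hM v (Finset.right_mem_Icc.2 huv)
  · refine (norm_sum_le _ _).trans (Finset.sum_le_sum fun n hn => ?_)
    rw [norm_mul]
    gcongr
    exact hM n (Finset.Ico_subset_Icc_self hn)

theorem sum_inv_sq_symm_le (H N : ℕ) :
    ∑ b ∈ (Finset.Icc (-(2 * N : ℤ)) (2 * N)).filter (fun b => (H : ℤ) < |b|),
      ((b : ℝ) ^ 2)⁻¹ ≤ 4 / (H + 1) := by
  have hsub : (Finset.Icc (-(2 * N : ℤ)) (2 * N)).filter (fun b => (H : ℤ) < |b|) ⊆
      (Finset.Ioo H (2 * N + 1)).image (fun n : ℕ => (n : ℤ)) ∪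
        (Finset.Ioo H (2 * N + 1)).image (fun n : ℕ => -(n : ℤ)) := by
    intro b hb
    simp only [Finset.mem_filter, Finset.mem_Icc] at hb
    simp only [Finset.mem_union, Finset.mem_image, Finset.mem_Ioo]
    rcases le_or_gt 0 b with h | h
    · rw [abs_of_nonneg h] at hb
      exact Or.inl ⟨b.toNat, by omega, by omega⟩
    · rw [abs_of_neg h] at hb
      exact Or.inr ⟨(-b).toNat, by omega, by omega⟩
  refine (Finset.sum_le_sum_of_subset_of_nonneg hsub fun _ _ _ => by positivity).trans ?_
  have hsum := sum_Ioo_inv_sq_le (α := ℝ) H (2 * N + 1)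
  rw [Finset.sum_union (by
      rw [Finset.disjoint_left]
      intro b hb hb'
      simp only [Finset.mem_image, Finset.mem_Ioo] at hb hb'
      obtain ⟨n, hn, rfl⟩ := hb
      obtain ⟨n', hn', h⟩ := hb'
      omega), Finset.sum_image (by intro a _ b _ h; simpa using h),
    Finset.sum_image (by intro a _ b _ h; simpa using h)]
  push_cast
  simp only [neg_sq]
  have : (4 : ℝ) / (H + 1) = 2 / (H + 1) + 2 / (H + 1) := by ring
  rw [this]
  exact add_le_add hsum hsum

/-- Sums over a shifted interval by Fourier inversion modulo `4 N + 1`. -/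
theorem sum_shifted_eq (g : ℤ → ℂ) (N h : ℕ) (u v : ℤ) (hu : -(N : ℤ) ≤ u) (hv : v ≤ N)
    (hh : h ≤ N) :
    (4 * N + 1 : ℂ) * ∑ n ∈ Finset.Icc (-(N : ℤ)) N, (if n - h ∈ Finset.Icc u v then g n else 0) =
      ∑ b ∈ Finset.Icc (-(2 * N : ℤ)) (2 * N),
        (∑ m ∈ Finset.Icc u v, addChar (m * (-(b : ℝ) / (4 * N + 1)))) *
        addChar (h * (-(b : ℝ) / (4 * N + 1))) *
        ∑ n ∈ Finset.Icc (-(N : ℤ)) N, g n * addChar (b / (4 * N + 1) * n) := by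
  have h1 : ∀ n ∈ Finset.Icc (-(N : ℤ)) N,
      (4 * N + 1 : ℂ) * (if n - h ∈ Finset.Icc u v then g n else 0) =
      ∑ m ∈ Finset.Icc u v, ∑ b ∈ Finset.Icc (-(2 * N : ℤ)) (2 * N),
        g n * addChar (b * ((n - h - m : ℤ) / (4 * N + 1))) := by
    intro n hn
    rw [Finset.mem_Icc] at hn
    have : ∀ m ∈ Finset.Icc u v, ∑ b ∈ Finset.Icc (-(2 * N : ℤ)) (2 * N),
        g n * addChar (b * ((n - h - m : ℤ) / (4 * N + 1))) =
        if n - h = m then g n * (4 * N + 1) else 0 := by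
      intro m hm
      rw [Finset.mem_Icc] at hm
      -- Here |n - h - m| ≤ 3N < 4N + 1, so congruence modulo 4N + 1 is equality.
      rw [← Finset.mul_sum, sum_addChar_orthogonality N (n - h - m) (by rw [abs_lt]; omega),
        mul_ite, mul_zero]
      simp only [sub_eq_zero]
    rw [Finset.sum_congr rfl this, Finset.sum_ite_eq]
    split_ifs <;> ring
  rw [Finset.mul_sum, Finset.sum_congr rfl h1]
  rw [Finset.sum_congr rfl fun n _ => Finset.sum_comm, Finset.sum_comm]
  refine Finset.sum_congr rfl fun b _ => ?_
  rw [Finset.mul_sum]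
  refine Finset.sum_congr rfl fun n _ => ?_
  rw [Finset.sum_mul, Finset.sum_mul]
  refine Finset.sum_congr rfl fun m _ => ?_
  have : (b : ℝ) * ((n - h - m : ℤ) / (4 * N + 1)) = m * (-(b : ℝ) / (4 * N + 1)) +
      h * (-(b : ℝ) / (4 * N + 1)) + b / (4 * N + 1) * n := by
    push_cast; ring
  rw [this, addChar_add, addChar_add]
  ring

/-- A shift by h changes membership in the interval only for h integers at each end. -/
theorem norm_sum_shifted_sub_le (g : ℤ → ℂ) (hg : ∀ n, ‖g n‖ ≤ 1) (N h : ℕ) (u v : ℤ)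
    (hu : -(N : ℤ) ≤ u) (hv : v ≤ N) :
    ‖∑ n ∈ Finset.Icc u v, g n -
      ∑ n ∈ Finset.Icc (-(N : ℤ)) N, (if n - h ∈ Finset.Icc u v then g n else 0)‖ ≤ 2 * h := by
  have h0 : ∑ n ∈ Finset.Icc u v, g n =
      ∑ n ∈ Finset.Icc (-(N : ℤ)) N, (if n ∈ Finset.Icc u v then g n else 0) := by
    rw [Finset.sum_ite_mem, Finset.inter_eq_right.2 (Finset.Icc_subset_Icc hu hv)]
  rw [h0, ← Finset.sum_sub_distrib]
  have hpt : ∀ n ∈ Finset.Icc (-(N : ℤ)) N,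
      ‖(if n ∈ Finset.Icc u v then g n else 0) - (if n - h ∈ Finset.Icc u v then g n else 0)‖ ≤
      if n ∈ Finset.Ico u (u + h) ∪ Finset.Ioc v (v + h) then (1 : ℝ) else 0 := by
    intro n _
    have h1 := hg n
    simp only [Finset.mem_Icc, Finset.mem_union, Finset.mem_Ico, Finset.mem_Ioc]
    split_ifs <;> first | (simp; done) | (simpa using h1) | (exfalso; omega)
  refine (norm_sum_le _ _).trans ((Finset.sum_le_sum hpt).trans ?_)
  rw [Finset.sum_ite_mem, Finset.sum_const, nsmul_eq_mul, mul_one]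
  have : (Finset.Icc (-(N : ℤ)) N ∩ (Finset.Ico u (u + h) ∪ Finset.Ioc v (v + h))).card ≤ 2 * h := by
    refine (Finset.card_le_card Finset.inter_subset_right).trans
      ((Finset.card_union_le _ _).trans ?_)
    rw [Int.card_Ico, Int.card_Ioc]
    omega
  exact_mod_cast this

/-- Interval sums are controlled by full sums twisted by characters of low frequency. -/
theorem norm_sum_Icc_le_of_twists {g : ℤ → ℂ} (hg : ∀ n, ‖g n‖ ≤ 1) {N H W : ℕ} {M : ℝ}
    (hN : 1 ≤ N) (hH : 1 ≤ H) (hW : 1 ≤ W) (hWN : W ≤ N)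
    (htw : ∀ b : ℤ, |b| ≤ H →
      ‖∑ n ∈ Finset.Icc (-(N : ℤ)) N, g n * addChar (b / (4 * N + 1) * n)‖ ≤ M)
    {u v : ℤ} (hu : -(N : ℤ) ≤ u) (hv : v ≤ N) :
    ‖∑ n ∈ Finset.Icc u v, g n‖ ≤ 2 * W + 3 * H * M + 15 * N ^ 2 / (W * H) := by
  set I := Finset.Icc u v with hI
  set B := Finset.Icc (-(2 * N : ℤ)) (2 * N) with hB
  have hN1 : (1 : ℝ) ≤ N := by exact_mod_cast hN
  have hH1 : (1 : ℝ) ≤ H := by exact_mod_cast hH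
  have hW1 : (1 : ℝ) ≤ W := by exact_mod_cast hW
  set L : ℝ := 4 * N + 1 with hL
  have hL0 : 0 < L := by positivity
  set U : ℤ → ℂ := fun b => ∑ m ∈ I, addChar (m * (-(b : ℝ) / L)) with hU
  set K : ℤ → ℂ := fun b => ∑ h ∈ Finset.range W, addChar (h * (-(b : ℝ) / L)) with hK
  set G : ℤ → ℂ := fun b => ∑ n ∈ Finset.Icc (-(N : ℤ)) N, g n * addChar (b / L * n) with hG
  set A : ℕ → ℂ := fun h =>
    ∑ n ∈ Finset.Icc (-(N : ℤ)) N, (if n - h ∈ I then g n else 0) with hA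
  have hM0 : 0 ≤ M := (norm_nonneg _).trans (htw 0 (by simp))
  have hG1 : ∀ b, ‖G b‖ ≤ 3 * N := by
    intro b
    have : ∀ n ∈ Finset.Icc (-(N : ℤ)) N, ‖g n * addChar (b / L * n)‖ ≤ 1 := fun n _ => by
      rw [norm_mul, norm_addChar, mul_one]; exact hg n
    refine (norm_sum_le_of_le _ this).trans ?_
    rw [Finset.sum_const, nsmul_eq_mul, mul_one]
    exact card_Icc_le N hN
  have hIc : (I.card : ℝ) ≤ L :=
    calc (I.card : ℝ) ≤ (Finset.Icc (-(N : ℤ)) N).card :=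
          Nat.cast_le.2 (Finset.card_le_card (Finset.Icc_subset_Icc hu hv))
      _ ≤ L := (card_Icc_le N hN).trans (by rw [hL]; linarith)
  have hU1 : ∀ b, ‖U b‖ ≤ L := by
    intro b
    refine (norm_sum_le_of_le (f := fun m : ℤ => addChar (m * (-(b : ℝ) / L))) I
      (n := fun _ => 1) fun m _ => (norm_addChar _).le).trans ?_
    rw [Finset.sum_const, nsmul_eq_mul, mul_one]
    exact hIc
  have hK1 : ∀ b, ‖K b‖ ≤ W := by
    intro b
    refine (norm_sum_le_of_le (f := fun m : ℕ => addChar (m * (-(b : ℝ) / L))) (Finset.range W)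
      (n := fun _ => 1) fun m _ => (norm_addChar _).le).trans ?_
    simp
  have hfreq : ∀ b ∈ B, b ≠ 0 → |(-(b : ℝ) / L)| = |(b : ℝ)| / L ∧ |(-(b : ℝ) / L)| ≤ 1 / 2 ∧
      (-(b : ℝ) / L) ≠ 0 := by
    intro b hb hb0
    have hb' : |b| ≤ 2 * N := abs_le.2 (Finset.mem_Icc.1 hb)
    have hb'' : |(b : ℝ)| ≤ 2 * N := by exact_mod_cast hb'
    have h1 : |(-(b : ℝ) / L)| = |(b : ℝ)| / L := by
      rw [abs_div, abs_neg, abs_of_pos hL0]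
    refine ⟨h1, ?_, ?_⟩
    · rw [h1, div_le_iff₀ hL0, hL]; linarith
    · have : (b : ℝ) ≠ 0 := by exact_mod_cast hb0
      exact div_ne_zero (neg_ne_zero.2 this) hL0.ne'
  have hgeo : ∀ b ∈ B, b ≠ 0 → ‖U b‖ ≤ L / (2 * |(b : ℝ)|) ∧ ‖K b‖ ≤ L / (2 * |(b : ℝ)|) := by
    intro b hb hb0
    obtain ⟨h1, h2, h3⟩ := hfreq b hb hb0
    have h4 : 1 / (2 * |(-(b : ℝ) / L)|) = L / (2 * |(b : ℝ)|) := by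
      have : |(b : ℝ)| ≠ 0 := abs_ne_zero.2 (by exact_mod_cast hb0)
      rw [h1]; field_simp
    rw [← h4]
    refine ⟨norm_sum_Icc_addChar_le u v _ h2 h3, ?_⟩
    have := norm_sum_range_addChar_le 0 (-(b : ℝ) / L) W h2 h3
    simpa using this
  -- averaging over the shifts
  have hsum : (L : ℂ) * ∑ h ∈ Finset.range W, A h = ∑ b ∈ B, U b * K b * G b := by
    rw [Finset.mul_sum, Finset.sum_congr rfl fun h hh => by
      have := sum_shifted_eq g N h u v hu hv ((Finset.mem_range.1 hh).le.trans hWN)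
      show (L : ℂ) * A h = ∑ b ∈ B, U b * addChar (h * (-(b : ℝ) / L)) * G b
      rw [← this, hL]
      push_cast
      rfl]
    rw [Finset.sum_comm]
    refine Finset.sum_congr rfl fun b _ => ?_
    rw [← Finset.sum_mul, ← Finset.mul_sum]
  have hlow : ∑ b ∈ B.filter (fun b => ¬ (H : ℤ) < |b|), ‖U b * K b * G b‖ ≤
      3 * H * (L * W * M) := by
    have hc : ((B.filter (fun b => ¬ (H : ℤ) < |b|)).card : ℝ) ≤ 3 * H := by
      refine le_trans (Nat.cast_le.2 (Finset.card_le_card fun b hb => ?_)) (card_Icc_le H hH)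
      have := (Finset.mem_filter.1 hb).2
      rw [not_lt, abs_le] at this
      exact Finset.mem_Icc.2 this
    refine (Finset.sum_le_card_nsmul _ _ (L * W * M) fun b hb => ?_).trans ?_
    · rw [norm_mul, norm_mul]
      have := htw b (not_lt.1 (Finset.mem_filter.1 hb).2)
      have := hU1 b
      have := hK1 b
      gcongr
    · rw [nsmul_eq_mul]
      gcongr
  -- Averaging over shifts supplies the second geometric sum `K`. Together the two decay like b⁻²,
  -- so frequencies beyond H are summable against the trivial bound 3N for the twisted sum.
  have hhigh : ∑ b ∈ B.filter (fun b => (H : ℤ) < |b|), ‖U b * K b * G b‖ ≤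
      3 * N * (L ^ 2 / H) := by
    have : ∀ b ∈ B.filter (fun b => (H : ℤ) < |b|), ‖U b * K b * G b‖ ≤
        3 * N * L ^ 2 / 4 * ((b : ℝ) ^ 2)⁻¹ := by
      intro b hb
      obtain ⟨hb1, hb2⟩ := Finset.mem_filter.1 hb
      have hb0 : b ≠ 0 := by rintro rfl; simp at hb2; omega
      obtain ⟨h1, h2⟩ := hgeo b hb1 hb0
      have h3 := hG1 b
      rw [norm_mul, norm_mul]
      have hbp : 0 < |(b : ℝ)| := abs_pos.2 (by exact_mod_cast hb0)
      calc ‖U b‖ * ‖K b‖ * ‖G b‖ ≤ L / (2 * |(b : ℝ)|) * (L / (2 * |(b : ℝ)|)) * (3 * N) := by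
            gcongr
        _ = 3 * N * L ^ 2 / 4 * (|(b : ℝ)| ^ 2)⁻¹ := by field_simp; norm_num
        _ = _ := by rw [sq_abs]
    refine (Finset.sum_le_sum this).trans ?_
    rw [← Finset.mul_sum]
    calc _ ≤ 3 * N * L ^ 2 / 4 * (4 / (H + 1)) := by
          gcongr
          exact sum_inv_sq_symm_le H N
      _ ≤ 3 * N * L ^ 2 / 4 * (4 / H) := by gcongr; linarith
      _ = _ := by ring
  have hav : ‖∑ h ∈ Finset.range W, A h‖ ≤ W * (3 * H * M) + 3 * N * (L / H) := by
    have h1 : L * ‖∑ h ∈ Finset.range W, A h‖ ≤ 3 * H * (L * W * M) + 3 * N * (L ^ 2 / H) := by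
      have : L * ‖∑ h ∈ Finset.range W, A h‖ = ‖(L : ℂ) * ∑ h ∈ Finset.range W, A h‖ := by
        rw [norm_mul, Complex.norm_real, Real.norm_of_nonneg hL0.le]
      rw [this, hsum]
      refine (norm_sum_le _ _).trans ?_
      rw [← Finset.sum_filter_add_sum_filter_not B (fun b => (H : ℤ) < |b|)]
      linarith
    refine le_of_mul_le_mul_left (h1.trans (le_of_eq ?_)) hL0
    ring
  have hdiff : ‖W * ∑ n ∈ I, g n - ∑ h ∈ Finset.range W, A h‖ ≤ W * (2 * W) := by
    have : (W : ℂ) * ∑ n ∈ I, g n - ∑ h ∈ Finset.range W, A h =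
        ∑ h ∈ Finset.range W, (∑ n ∈ I, g n - A h) := by
      rw [Finset.sum_sub_distrib, Finset.sum_const, Finset.card_range, nsmul_eq_mul]
    rw [this]
    refine (norm_sum_le_of_le (n := fun _ => 2 * (W : ℝ)) _ fun h hh => ?_).trans ?_
    · refine (norm_sum_shifted_sub_le g hg N h u v hu hv).trans ?_
      gcongr
      exact (Finset.mem_range.1 hh).le
    · simp
  have hfin : (W : ℝ) * ‖∑ n ∈ I, g n‖ ≤ W * (2 * W) + (W * (3 * H * M) + 3 * N * (L / H)) := by
    have : (W : ℝ) * ‖∑ n ∈ I, g n‖ = ‖(W : ℂ) * ∑ n ∈ I, g n‖ := by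
      rw [norm_mul, Complex.norm_natCast]
    rw [this]
    calc _ = ‖(W * ∑ n ∈ I, g n - ∑ h ∈ Finset.range W, A h) + ∑ h ∈ Finset.range W, A h‖ := by
          rw [sub_add_cancel]
      _ ≤ _ := (norm_add_le _ _).trans (add_le_add hdiff hav)
  have hW0 : (0 : ℝ) < W := by linarith
  refine le_of_mul_le_mul_left (hfin.trans ?_) hW0
  have h1 : 3 * N * (L / H) ≤ 15 * N ^ 2 / H := by
    rw [mul_div_assoc']
    refine div_le_div_of_nonneg_right ?_ (by positivity)
    rw [hL]; nlinarith
  have h2 : (W : ℝ) * (2 * W + 3 * H * M + 15 * N ^ 2 / (W * H)) =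
      W * (2 * W) + (W * (3 * H * M) + 15 * N ^ 2 / H) := by
    field_simp; ring
  rw [h2]
  linarith

/-! ### One-variable sums over a polynomially regular set -/

/-- The term `e(P(n))` restricted to the elements of `A` in the residue class `r mod Q`. -/
noncomputable def phaseTerm (A : Set ℤ) (Q : ℕ) (r : ℤ) (P : Polynomial ℝ) : ℤ → ℂ :=
  Set.indicator {m : ℤ | m ∈ A ∧ m ≡ r [ZMOD (Q : ℤ)]} (fun m => addChar (P.eval (m : ℝ)))

theorem phaseTerm_of_mem {A : Set ℤ} {Q : ℕ} {r n : ℤ} {P : Polynomial ℝ}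
    (h : n ∈ A ∧ n ≡ r [ZMOD Q]) : phaseTerm A Q r P n = addChar (P.eval (n : ℝ)) :=
  Set.indicator_of_mem (s := {m : ℤ | m ∈ A ∧ m ≡ r [ZMOD (Q : ℤ)]}) h _

theorem phaseTerm_of_notMem {A : Set ℤ} {Q : ℕ} {r n : ℤ} {P : Polynomial ℝ}
    (h : ¬ (n ∈ A ∧ n ≡ r [ZMOD Q])) : phaseTerm A Q r P n = 0 :=
  Set.indicator_of_notMem (s := {m : ℤ | m ∈ A ∧ m ≡ r [ZMOD (Q : ℤ)]}) h _

theorem norm_phaseTerm_le (A : Set ℤ) (Q : ℕ) (r : ℤ) (P : Polynomial ℝ) (n : ℤ) :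
    ‖phaseTerm A Q r P n‖ ≤ 1 := by
  rw [phaseTerm, norm_indicator_eq_indicator_norm]
  exact Set.indicator_le' (fun _ _ => (norm_addChar _).le) (fun _ _ => zero_le_one) n

theorem exists_log_pow_le (m : ℕ) :
    ∃ T : ℝ, ∀ N : ℕ, T ≤ Real.log N → 2 ≤ Real.log N ∧ Real.log N ^ m ≤ N := by
  refine ⟨(m + 1).factorial + 2, fun N hN => ?_⟩
  have hf : (0 : ℝ) < (m + 1).factorial := by exact_mod_cast Nat.factorial_pos _
  have h2 : 2 ≤ Real.log N := by linarith
  refine ⟨h2, ?_⟩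
  have hN0 : (0 : ℝ) < N := by
    rcases Nat.eq_zero_or_pos N with rfl | h
    · simp at h2; linarith
    · exact_mod_cast h
  have h3 := Real.pow_div_factorial_le_exp (Real.log N) (by linarith) (m + 1)
  rw [Real.exp_log hN0, div_le_iff₀ hf, pow_succ] at h3
  have h4 : (N : ℝ) * (m + 1).factorial ≤ N * Real.log N := by gcongr; linarith
  exact le_of_mul_le_mul_right (h3.trans h4) (by linarith)

/-- Polynomial regularity with natural exponents, all residues, any constant term, and without
constants, for large `N`. -/
theorem PolynomiallyRegular.exists_bound {A : Set ℤ} (hA : PolynomiallyRegular A) {d : ℕ}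
    (hd : 1 ≤ d) (a a₁ : ℕ) : ∃ (b : ℕ) (T : ℝ), ∀ N : ℕ, T ≤ Real.log N →
      ∀ Q : ℕ, 1 ≤ Q → (Q : ℝ) ≤ Real.log N ^ a₁ →
      ∀ (P : Polynomial ℝ) (c q : ℕ), Nat.Coprime c q → 1 ≤ c → c ≤ q →
        P.natDegree ≤ d → P.coeff d = (c : ℝ) / (q : ℝ) →
        Real.log N ^ b ≤ (q : ℝ) → (q : ℝ) ≤ (N : ℝ) ^ d / Real.log N ^ b →
      ∀ r : ℤ, ‖∑ n ∈ Finset.Icc (-(N : ℤ)) N, phaseTerm A Q r P n‖ ≤ N / Real.log N ^ a := by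
  obtain ⟨β₀, hβ₀, C, hC, h⟩ := hA d hd (a + 1) (by positivity) (a₁ + 1) (by positivity)
  -- The exponent a + 1 leaves one spare logarithm, which swallows C once log N ≥ C; the +1 in a₁ +
  -- 1 keeps that exponent positive.
  refine ⟨⌈β₀⌉₊ + 1, max 2 C, fun N hN Q hQ hQl P c q hcq hc1 hcq' hP hco hq1 hq2 r => ?_⟩
  have hl2 : 2 ≤ Real.log N := (le_max_left _ _).trans hN
  have hlC : C ≤ Real.log N := (le_max_right _ _).trans hN
  have hl0 : 0 < Real.log N := by linarith
  have hN2 : 2 ≤ N := by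
    by_contra hlt
    have : N = 0 ∨ N = 1 := by omega
    rcases this with rfl | rfl <;> simp at hl2 <;> linarith
  have hQ0 : (0 : ℤ) < Q := by exact_mod_cast hQ
  have hQ1 : (1 : ℝ) ≤ Q := by exact_mod_cast hQ
  have hr0 : 0 ≤ (r - 1) % (Q : ℤ) := Int.emod_nonneg _ hQ0.ne'
  have hr1 : (r - 1) % (Q : ℤ) < Q := Int.emod_lt_of_pos _ hQ0
  have hrc : (((r - 1) % (Q : ℤ) + 1).toNat : ℤ) = (r - 1) % (Q : ℤ) + 1 :=
    Int.toNat_of_nonneg (by omega)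
  have hmod : (((r - 1) % (Q : ℤ) + 1).toNat : ℤ) ≡ r [ZMOD Q] := by
    rw [hrc]
    have := (Int.mod_modEq (r - 1) Q).add_right 1
    rwa [sub_add_cancel] at this
  have key := h N hN2 Q hQ (by
      rw [← Nat.cast_succ, Real.rpow_natCast]
      exact hQl.trans (pow_le_pow_right₀ (by linarith) (Nat.le_succ _)))
    ((⌈β₀⌉₊ + 1 : ℕ) : ℝ) (by push_cast; linarith [Nat.le_ceil β₀])
    (P - Polynomial.C (P.coeff 0)) c q hcq hc1 hcq' (by
      rw [Polynomial.natDegree_sub_C]; exact hP) (by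
      rw [Polynomial.coeff_sub, Polynomial.coeff_C_of_ne_zero (by omega), sub_zero, hco])
    (by simp) (by rwa [Real.rpow_natCast]) (by
      rwa [Real.rpow_neg hl0.le, Real.rpow_natCast, ← div_eq_mul_inv])
    ((r - 1) % (Q : ℤ) + 1).toNat (by omega) (by omega)
  have hterm : ∀ n : ℤ, phaseTerm A Q r P n = addChar (P.coeff 0) *
      Set.indicator {m : ℤ | m ∈ A ∧ m ≡ (((r - 1) % (Q : ℤ) + 1).toNat : ℤ) [ZMOD (Q : ℤ)]}
        (fun m => addChar ((P - Polynomial.C (P.coeff 0)).eval (m : ℝ))) n := by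
    intro n
    have hset : {m : ℤ | m ∈ A ∧ m ≡ r [ZMOD (Q : ℤ)]} =
        {m : ℤ | m ∈ A ∧ m ≡ (((r - 1) % (Q : ℤ) + 1).toNat : ℤ) [ZMOD (Q : ℤ)]} := by
      ext m
      exact and_congr_right fun _ => ⟨fun h => h.trans hmod.symm, fun h => h.trans hmod⟩
    rw [phaseTerm, hset, ← Set.indicator_const_mul]
    congr 1
    funext m
    rw [← addChar_add]
    congr 1
    simp
  simp_rw [hterm]
  rw [← Finset.mul_sum, norm_mul, norm_addChar, one_mul]
  refine key.trans ?_
  rw [← Nat.cast_succ, Real.rpow_neg hl0.le, Real.rpow_natCast]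
  calc C * (Q : ℝ)⁻¹ * N * (Real.log N ^ (a + 1))⁻¹
      ≤ Real.log N * 1 * N * (Real.log N ^ (a + 1))⁻¹ := by
        gcongr
        exact inv_le_one_of_one_le₀ hQ1
    _ = N / Real.log N ^ a := by rw [pow_succ]; field_simp

/-- When X ≤ Z the tolerance is at least 1, so rounding x suffices. -/
theorem IsMajor.of_lt {Z X x : ℝ} (hZ : 1 ≤ Z) (hX : 0 < X) (h : X ≤ Z) : IsMajor Z X x := by
  refine ⟨1, le_rfl, by simpa using hZ, round x, ?_⟩
  rw [Nat.cast_one, one_mul]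
  refine (abs_sub_round x).trans ?_
  rw [le_div_iff₀ hX]
  linarith

/-- Dirichlet approximation replaces the top coefficient by a rational whose denominator is at most
N^d/l^b. Minority makes that denominator exceed a large power of log N, so regularity applies and
the replacement changes each term by less than the bound sought. -/
theorem PolynomiallyRegular.exists_bound_minor {A : Set ℤ} (hA : PolynomiallyRegular A) {d : ℕ}
    (hd : 1 ≤ d) (a a₁ : ℕ) : ∃ (B : ℕ) (T : ℝ), ∀ N : ℕ, T ≤ Real.log N →
      ∀ Q : ℕ, 1 ≤ Q → (Q : ℝ) ≤ Real.log N ^ a₁ →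
      ∀ P : Polynomial ℝ, P.natDegree ≤ d →
        ¬ IsMajor (Real.log N ^ B) ((N : ℝ) ^ d) (P.coeff d) →
      ∀ r : ℤ, ‖∑ n ∈ Finset.Icc (-(N : ℤ)) N, phaseTerm A Q r P n‖ ≤ N / Real.log N ^ a := by
  obtain ⟨b, T, h⟩ := hA.exists_bound hd (a + 1) a₁
  obtain ⟨T', hT'⟩ := exists_log_pow_le 0
  refine ⟨b + a + 6, max T T', fun N hN Q hQ hQl P hP hmin r => ?_⟩
  have hl2 := (hT' N ((le_max_right _ _).trans hN)).1
  replace h := h N ((le_max_left _ _).trans hN) Q hQ hQl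
  set l := Real.log N with hl
  have hl0 : 0 < l := by linarith
  have hl1 : 1 ≤ l := by linarith
  have pw : ∀ m n : ℕ, m ≤ n → l ^ m ≤ l ^ n := fun m n h => pow_le_pow_right₀ hl1 h
  have hN1 : 1 ≤ N := by
    rcases Nat.eq_zero_or_pos N with rfl | h
    · simp at hl; linarith
    · exact h
  have hN0 : (0 : ℝ) < N := by exact_mod_cast hN1
  have hNd : (0 : ℝ) < (N : ℝ) ^ d := by positivity
  set x := P.coeff d with hx
  have hbig : l ^ (b + a + 6) < (N : ℝ) ^ d := by
    by_contra hle
    exact hmin (IsMajor.of_lt (one_le_pow₀ hl1) hNd (not_lt.1 hle))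
  have hR1 : 1 ≤ (N : ℝ) ^ d / l ^ b := by
    rw [le_div_iff₀ (by positivity), one_mul]
    exact (pw _ _ (by omega)).trans hbig.le
  obtain ⟨ρ, hρ1, hρ2⟩ := Real.exists_rat_abs_sub_le_and_den_le x (Nat.floor_pos.2 hR1)
  have hden0 : (0 : ℝ) < ρ.den := by exact_mod_cast ρ.den_pos
  have hden2 : (ρ.den : ℝ) ≤ (N : ℝ) ^ d / l ^ b :=
    (Nat.cast_le.2 hρ2).trans (Nat.floor_le (by positivity))
  have hρ3 : |x - ρ| ≤ l ^ b / N ^ d / ρ.den := by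
    refine hρ1.trans ?_
    have h1 := (div_lt_iff₀ (pow_pos hl0 b)).1 (Nat.lt_floor_add_one ((N : ℝ) ^ d / l ^ b))
    rw [div_div, div_le_div_iff₀ (by positivity) (by positivity), one_mul, ← mul_assoc]
    gcongr
    linarith
  have hden : l ^ (b + a + 6) < ρ.den := by
    by_contra hle
    refine hmin ⟨ρ.den, ρ.den_pos, not_lt.1 hle, ρ.num, ?_⟩
    have h1 : (ρ.den : ℝ) * x - ρ.num = ρ.den * (x - ρ) := by
      rw [mul_sub]
      congr 1
      conv_rhs => rw [Rat.cast_def]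
      field_simp
    rw [h1, abs_mul, abs_of_pos hden0]
    calc (ρ.den : ℝ) * |x - ρ| ≤ ρ.den * (l ^ b / N ^ d / ρ.den) := by gcongr
      _ = l ^ b / N ^ d := by field_simp
      _ ≤ _ := by
        have := pw b (b + a + 6) (by omega)
        gcongr
  have hdenN : 2 ≤ ρ.den := by
    have h1 : (1 : ℝ) < ρ.den := (one_le_pow₀ hl1).trans_lt hden
    exact_mod_cast h1
  have hdZ : (0 : ℤ) < ρ.den := by exact_mod_cast ρ.den_pos
  -- At integer points only the numerator modulo the denominator matters. Its residue is nonzero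
  -- because the denominator is at least 2 and coprime to it.
  obtain ⟨c, hc⟩ : ∃ c : ℕ, (c : ℤ) = ρ.num % ρ.den :=
    ⟨_, Int.toNat_of_nonneg (Int.emod_nonneg _ hdZ.ne')⟩
  set k := ρ.num / (ρ.den : ℤ) with hk
  have hck : (c : ℤ) + ρ.den * k = ρ.num := by rw [hc]; exact Int.emod_add_mul_ediv _ _
  have hcop : Nat.Coprime c ρ.den := by
    have h1 : IsCoprime ρ.num (ρ.den : ℤ) := by
      rw [Int.isCoprime_iff_gcd_eq_one]; exact ρ.reduced
    rw [← hck] at h1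
    exact Nat.isCoprime_iff_coprime.1 (IsCoprime.of_add_mul_left_left h1)
  have hc1 : 1 ≤ c := by
    rcases Nat.eq_zero_or_pos c with rfl | h
    · rw [Nat.coprime_zero_left] at hcop; omega
    · exact h
  have hcd : c ≤ ρ.den := by
    have := Int.emod_lt_of_pos ρ.num hdZ
    omega
  have hρc : (ρ : ℝ) = c / ρ.den + k := by
    rw [Rat.cast_def, ← hck]
    push_cast
    field_simp
  set P' := P + Polynomial.monomial d ((c : ℝ) / ρ.den - x) with hP'
  have hP'd : P'.natDegree ≤ d :=
    Polynomial.natDegree_add_le_of_degree_le hP (Polynomial.natDegree_monomial_le _)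
  have hP'c : P'.coeff d = (c : ℝ) / ρ.den := by
    rw [hP', Polynomial.coeff_add, Polynomial.coeff_monomial_same, ← hx]; ring
  have key := h P' c ρ.den hcop hc1 hcd hP'd hP'c ((pw _ _ (by omega)).trans hden.le) hden2 r
  have hterm : ∀ n ∈ Finset.Icc (-(N : ℤ)) N,
      ‖phaseTerm A Q r P n - phaseTerm A Q r P' n‖ ≤ 1 / (3 * l ^ (a + 1)) := by
    intro n hn
    by_cases hnA : n ∈ A ∧ n ≡ r [ZMOD Q]
    swap
    · rw [phaseTerm_of_notMem hnA, phaseTerm_of_notMem hnA, sub_zero, norm_zero]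
      positivity
    rw [phaseTerm_of_mem hnA, phaseTerm_of_mem hnA]
    have hnN : |(n : ℝ)| ≤ N := by
      have := Finset.mem_Icc.1 hn
      rw [abs_le]
      exact ⟨by exact_mod_cast this.1, by exact_mod_cast this.2⟩
    have h1 : P'.eval (n : ℝ) = P.eval (n : ℝ) + (ρ - x) * n ^ d + ((-k * n ^ d : ℤ) : ℝ) := by
      rw [hP', Polynomial.eval_add, Polynomial.eval_monomial, hρc]
      push_cast; ring
    rw [h1, addChar_add_intCast]
    refine (norm_addChar_sub_le _ _).trans ?_
    have h2 : P.eval (n : ℝ) - (P.eval (n : ℝ) + (ρ - x) * n ^ d) = (x - ρ) * n ^ d := by ring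
    rw [h2, abs_mul, abs_pow]
    calc 7 * (|x - ρ| * |(n : ℝ)| ^ d) ≤ 7 * (l ^ b / N ^ d / ρ.den * N ^ d) := by gcongr
      _ = 7 * l ^ b / ρ.den := by field_simp
      _ ≤ 7 * l ^ b / l ^ (b + a + 6) := by gcongr
      _ ≤ 1 / (3 * l ^ (a + 1)) := by
        rw [div_le_div_iff₀ (by positivity) (by positivity)]
        calc 7 * l ^ b * (3 * l ^ (a + 1)) = 21 * l ^ (b + a + 1) := by ring
          _ ≤ l ^ (b + a + 6) := const_mul_pow_le hl2 5 _ _ (by norm_num) (by omega)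
          _ = _ := (one_mul _).symm
  have hdiff : ‖∑ n ∈ Finset.Icc (-(N : ℤ)) N, (phaseTerm A Q r P n - phaseTerm A Q r P' n)‖ ≤
      N / l ^ (a + 1) := by
    refine (norm_sum_le_of_le _ hterm).trans ?_
    rw [Finset.sum_const, nsmul_eq_mul]
    calc _ ≤ 3 * (N : ℝ) * (1 / (3 * l ^ (a + 1))) := by
          gcongr
          exact card_Icc_le N hN1
      _ = _ := by field_simp
  rw [Finset.sum_sub_distrib] at hdiff
  have h1 := norm_le_norm_add_norm_sub' (∑ n ∈ Finset.Icc (-(N : ℤ)) N, phaseTerm A Q r P n)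
    (∑ n ∈ Finset.Icc (-(N : ℤ)) N, phaseTerm A Q r P' n)
  have h2 : N / l ^ (a + 1) + N / l ^ (a + 1) ≤ N / l ^ a := by
    rw [← add_div, div_le_div_iff₀ (by positivity) (by positivity)]
    calc ((N : ℝ) + N) * l ^ a = N * (2 * l ^ a) := by ring
      _ ≤ N * l ^ (a + 1) := by
        gcongr
        exact const_mul_pow_le hl2 1 _ _ (by norm_num) (by omega)
  linarith

theorem phaseTerm_mul_addChar (A : Set ℤ) (Q : ℕ) (r : ℤ) (P : Polynomial ℝ) (θ : ℝ) (n : ℤ) :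
    phaseTerm A Q r P n * addChar (θ * n) =
      phaseTerm A Q r (P + Polynomial.monomial 1 θ) n := by
  by_cases h : n ∈ A ∧ n ≡ r [ZMOD Q]
  · rw [phaseTerm_of_mem h, phaseTerm_of_mem h, Polynomial.eval_add, Polynomial.eval_monomial,
      pow_one, addChar_add]
  · rw [phaseTerm_of_notMem h, phaseTerm_of_notMem h, zero_mul]

theorem IsMajor.of_add {Z X x y D : ℝ} (h : IsMajor Z X (x + y)) (hX : 0 < X) (hD : 1 ≤ D)
    (hy : Z * |y| ≤ Z * (D - 1) / X) : IsMajor (D * Z) X x := by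
  obtain ⟨q, h1, h2, m, h3⟩ := h
  have hq : (1 : ℝ) ≤ q := by exact_mod_cast h1
  refine ⟨q, h1, h2.trans (le_mul_of_one_le_left (by linarith) hD), m, ?_⟩
  have : (q : ℝ) * x - m = (q * (x + y) - m) - q * y := by ring
  rw [this]
  refine (abs_sub _ _).trans ?_
  rw [abs_mul, Nat.abs_cast]
  have h4 : (q : ℝ) * |y| ≤ Z * |y| := by gcongr
  have h5 : D * Z / X = Z / X + Z * (D - 1) / X := by field_simp; ring
  linarith

/-- Interval sums when the top coefficient is minor. -/
theorem PolynomiallyRegular.exists_bound_Icc {A : Set ℤ} (hA : PolynomiallyRegular A) {d : ℕ}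
    (hd : 1 ≤ d) (a a₁ : ℕ) : ∃ (B : ℕ) (T : ℝ), ∀ N : ℕ, T ≤ Real.log N →
      ∀ Q : ℕ, 1 ≤ Q → (Q : ℝ) ≤ Real.log N ^ a₁ →
      ∀ P : Polynomial ℝ, P.natDegree ≤ d →
        ¬ IsMajor (Real.log N ^ B) ((N : ℝ) ^ d) (P.coeff d) →
      ∀ (r u v : ℤ), -(N : ℤ) ≤ u → v ≤ N →
        ‖∑ n ∈ Finset.Icc u v, phaseTerm A Q r P n‖ ≤ N / Real.log N ^ a := by
  obtain ⟨B, T, h⟩ := hA.exists_bound_minor hd (3 * a + 16) a₁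
  obtain ⟨T', hT'⟩ := exists_log_pow_le (a + 4)
  refine ⟨B + 2 * a + 11, max T T', fun N hN Q hQ hQl P hP hmin r u v hu hv => ?_⟩
  obtain ⟨hl2, hlN⟩ := hT' N ((le_max_right _ _).trans hN)
  replace h := h N ((le_max_left _ _).trans hN) Q hQ hQl
  set l := Real.log N with hl
  have hl0 : 0 < l := by linarith
  have hl1 : 1 ≤ l := by linarith
  have pw : ∀ m n : ℕ, m ≤ n → l ^ m ≤ l ^ n := fun m n h => pow_le_pow_right₀ hl1 h
  have hN0 : (0 : ℝ) < N := lt_of_lt_of_le (by positivity) hlN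
  have hN1 : 1 ≤ N := by exact_mod_cast hN0
  have hN1' : (1 : ℝ) ≤ N := by exact_mod_cast hN1
  have hNd : (0 : ℝ) < (N : ℝ) ^ d := by positivity
  have hW2 : 2 ≤ (N : ℝ) / l ^ (a + 3) := by
    rw [le_div_iff₀ (by positivity)]
    exact (const_mul_pow_le hl2 1 _ _ (by norm_num) (by omega)).trans hlN
  -- W is small enough that the shifts are negligible, H large enough to make N²/(WH) small, and the
  -- saving in M outweighs the factor H.
  obtain ⟨W, hW⟩ : ∃ W, W = ⌊(N : ℝ) / l ^ (a + 3)⌋₊ := ⟨_, rfl⟩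
  have hWle : (W : ℝ) ≤ N / l ^ (a + 3) := hW ▸ Nat.floor_le (by positivity)
  have hWge : (N : ℝ) / l ^ (a + 3) / 2 ≤ W := by
    have := Nat.lt_floor_add_one ((N : ℝ) / l ^ (a + 3))
    rw [← hW] at this
    linarith
  have hW0 : (0 : ℝ) < W := by linarith
  have hWN : W ≤ N := by
    have : (W : ℝ) ≤ N := hWle.trans (div_le_self hN0.le (one_le_pow₀ hl1))
    exact_mod_cast this
  obtain ⟨H, hH⟩ : ∃ H, H = ⌈l ^ (2 * a + 10)⌉₊ := ⟨_, rfl⟩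
  have hHge : l ^ (2 * a + 10) ≤ H := hH ▸ Nat.le_ceil _
  have hHle : (H : ℝ) ≤ 2 * l ^ (2 * a + 10) := by
    have h1 := Nat.ceil_lt_add_one (show 0 ≤ l ^ (2 * a + 10) by positivity)
    have h2 : 1 ≤ l ^ (2 * a + 10) := one_le_pow₀ hl1
    rw [← hH] at h1
    linarith
  have hH0 : (0 : ℝ) < H := lt_of_lt_of_le (by positivity) hHge
  have htw : ∀ b : ℤ, |b| ≤ H → ‖∑ n ∈ Finset.Icc (-(N : ℤ)) N,
      phaseTerm A Q r P n * addChar (b / (4 * N + 1) * n)‖ ≤ N / l ^ (3 * a + 16) := by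
    intro b hb
    simp_rw [phaseTerm_mul_addChar]
    -- The twist touches only the linear coefficient. If d = 1 this is the top one, moved by at most
    -- H/(4N + 1), which the factor l^(2a + 11) absorbs.
    refine h _ (Polynomial.natDegree_add_le_of_degree_le hP
      ((Polynomial.natDegree_monomial_le _).trans hd)) (fun hmaj => hmin ?_) r
    rw [Polynomial.coeff_add, Polynomial.coeff_monomial] at hmaj
    have hpow : l ^ (2 * a + 11) * l ^ B = l ^ (B + 2 * a + 11) := by ring
    rw [← hpow]
    have hD : 1 ≤ l ^ (2 * a + 11) := one_le_pow₀ hl1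
    refine hmaj.of_add hNd hD ?_
    split_ifs with h1
    · rw [mul_div_assoc]
      gcongr
      subst h1
      have hb' : |(b : ℝ)| ≤ H := by exact_mod_cast hb
      rw [abs_div, abs_of_pos (show (0 : ℝ) < 4 * N + 1 by positivity), pow_one,
        div_le_div_iff₀ (by positivity) hN0]
      have h2 : 2 * l ^ (2 * a + 10) ≤ l ^ (2 * a + 11) :=
        const_mul_pow_le hl2 1 _ _ (by norm_num) (by omega)
      have h3 : 1 ≤ l ^ (2 * a + 10) := one_le_pow₀ hl1
      calc |(b : ℝ)| * N ≤ (2 * l ^ (2 * a + 10)) * N := by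
            gcongr
            exact hb'.trans hHle
        _ ≤ (l ^ (2 * a + 11) - 1) * (4 * N + 1) := by nlinarith
    · rw [abs_zero, mul_zero]
      have : 0 ≤ l ^ (2 * a + 11) - 1 := by linarith
      positivity
  have key := norm_sum_Icc_le_of_twists (norm_phaseTerm_le A Q r P) hN1
    (by exact_mod_cast hH0) (by exact_mod_cast hW0) hWN htw hu hv
  refine key.trans ?_
  have e1 : 2 * (W : ℝ) ≤ N / l ^ (a + 2) := by
    calc 2 * (W : ℝ) ≤ 2 * (N / l ^ (a + 3)) := by gcongr
      _ ≤ N / l ^ (a + 2) := by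
        rw [mul_div_assoc', div_le_div_iff₀ (by positivity) (by positivity)]
        calc 2 * (N : ℝ) * l ^ (a + 2) = N * (2 * l ^ (a + 2)) := by ring
          _ ≤ _ := by
            gcongr
            exact const_mul_pow_le hl2 1 _ _ (by norm_num) (by omega)
  have e2 : 3 * (H : ℝ) * (N / l ^ (3 * a + 16)) ≤ N / l ^ (a + 2) := by
    calc 3 * (H : ℝ) * (N / l ^ (3 * a + 16))
        ≤ 3 * (2 * l ^ (2 * a + 10)) * (N / l ^ (3 * a + 16)) := by gcongr
      _ ≤ N / l ^ (a + 2) := by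
        rw [mul_div_assoc', div_le_div_iff₀ (by positivity) (by positivity)]
        calc 3 * (2 * l ^ (2 * a + 10)) * (N : ℝ) * l ^ (a + 2) = N * (6 * l ^ (3 * a + 12)) := by
              ring
          _ ≤ _ := by
            gcongr
            exact const_mul_pow_le hl2 3 _ _ (by norm_num) (by omega)
  have e3 : 15 * (N : ℝ) ^ 2 / (W * H) ≤ N / l ^ (a + 2) := by
    calc 15 * (N : ℝ) ^ 2 / (W * H)
        ≤ 15 * (N : ℝ) ^ 2 / (N / l ^ (a + 3) / 2 * l ^ (2 * a + 10)) := by gcongr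
      _ = 30 * N * l ^ (a + 3) / l ^ (2 * a + 10) := by field_simp; norm_num
      _ ≤ N / l ^ (a + 2) := by
        rw [div_le_div_iff₀ (by positivity) (by positivity)]
        calc 30 * (N : ℝ) * l ^ (a + 3) * l ^ (a + 2) = N * (30 * l ^ (2 * a + 5)) := by
              ring
          _ ≤ _ := by
            gcongr
            exact const_mul_pow_le hl2 5 _ _ (by norm_num) (by omega)
  have e4 : 3 * (N / l ^ (a + 2)) ≤ N / l ^ a := by
    rw [mul_div_assoc', div_le_div_iff₀ (by positivity) (by positivity)]
    calc 3 * (N : ℝ) * l ^ a = N * (3 * l ^ a) := by ring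
      _ ≤ _ := by
        gcongr
        exact const_mul_pow_le hl2 2 _ _ (by norm_num) (by omega)
  linarith

/-- Splitting a residue class modulo `Q` into classes modulo `Q q`. -/
theorem sum_phaseTerm_split (A : Set ℤ) {Q q : ℕ} (hQ : 1 ≤ Q) (hq : 1 ≤ q) (r : ℤ)
    (P : Polynomial ℝ) (s : Finset ℤ) :
    ∑ n ∈ s, phaseTerm A Q r P n = ∑ t ∈ (Finset.Ico (0 : ℤ) (Q * q : ℕ)).filter
      (fun t => t ≡ r [ZMOD Q]), ∑ n ∈ s, phaseTerm A (Q * q) t P n := by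
  rw [Finset.sum_comm]
  refine Finset.sum_congr rfl fun n _ => ?_
  have hpos : (0 : ℤ) < (Q * q : ℕ) := by exact_mod_cast Nat.mul_pos hQ hq
  have hdvd : (Q : ℤ) ∣ (Q * q : ℕ) := ⟨q, by push_cast; ring⟩
  by_cases hn : n ∈ A ∧ n ≡ r [ZMOD Q]
  · have hmem : n % (Q * q : ℕ) ∈ (Finset.Ico (0 : ℤ) (Q * q : ℕ)).filter
        (fun t => t ≡ r [ZMOD Q]) := by
      rw [Finset.mem_filter, Finset.mem_Ico]
      exact ⟨⟨Int.emod_nonneg _ hpos.ne', Int.emod_lt_of_pos _ hpos⟩,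
        ((Int.mod_modEq n _).of_dvd hdvd).trans hn.2⟩
    rw [phaseTerm_of_mem hn, Finset.sum_eq_single_of_mem _ hmem]
    · rw [phaseTerm_of_mem ⟨hn.1, (Int.mod_modEq n _).symm⟩]
    · intro t ht hne
      refine phaseTerm_of_notMem ?_
      rintro ⟨-, h⟩
      rw [Finset.mem_filter, Finset.mem_Ico] at ht
      refine hne ?_
      rw [h.eq, Int.emod_eq_of_lt ht.1.1 ht.1.2]
  · rw [phaseTerm_of_notMem hn]
    refine (Finset.sum_eq_zero fun t ht => phaseTerm_of_notMem ?_).symm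
    rintro ⟨h1, h2⟩
    exact hn ⟨h1, (h2.of_dvd hdvd).trans (Finset.mem_filter.1 ht).2⟩

theorem abs_pow_succ_sub_pow_le {x N : ℝ} (d : ℕ) (hx : |x| ≤ N) (hx' : |x + 1| ≤ N) :
    |(x + 1) ^ (d + 1) - x ^ (d + 1)| ≤ (d + 1) * N ^ d := by
  have h := abs_pow_sub_pow_le (x + 1) x (d + 1)
  refine h.trans ?_
  rw [add_sub_cancel_left, abs_one, one_mul, Nat.add_sub_cancel]
  push_cast
  gcongr
  exact max_le hx' hx

/-- On a class modulo a multiple of `q`, the phase `x n^d` with `x` close to `m / q` is constant up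
to a slowly varying factor. -/
theorem phaseTerm_eq_mul_erase (A : Set ℤ) {Q q : ℕ} (hq : 1 ≤ q) (t m : ℤ) (P : Polynomial ℝ)
    (d : ℕ) (n : ℤ) :
    phaseTerm A (Q * q) t P n = addChar (m * t ^ d / q) *
      (phaseTerm A (Q * q) t (P.erase d) n * addChar ((P.coeff d - m / q) * n ^ d)) := by
  by_cases h : n ∈ A ∧ n ≡ t [ZMOD (Q * q : ℕ)]
  · rw [phaseTerm_of_mem h, phaseTerm_of_mem h, ← addChar_add, ← addChar_add]
    have hq0 : (q : ℝ) ≠ 0 := by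
      have : q ≠ 0 := by omega
      exact_mod_cast this
    have h1 : n ≡ t [ZMOD q] := h.2.of_dvd ⟨Q, by push_cast; ring⟩
    obtain ⟨k, hk⟩ := (h1.pow d).symm.dvd
    have hk' : (n : ℝ) ^ d = t ^ d + q * k := by
      have : n ^ d = t ^ d + q * k := by linarith
      exact_mod_cast this
    rw [← addChar_add_intCast _ (-(m * k))]
    congr 1
    have hev : P.eval (n : ℝ) = P.coeff d * n ^ d + (P.erase d).eval (n : ℝ) := by
      conv_lhs => rw [← Polynomial.monomial_add_erase P d]
      rw [Polynomial.eval_add, Polynomial.eval_monomial]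
    have h2 : (m : ℝ) / q * n ^ d = m * t ^ d / q + m * k := by
      rw [hk']; field_simp
    rw [hev]
    push_cast
    linear_combination h2
  · rw [phaseTerm_of_notMem h, phaseTerm_of_notMem h, zero_mul, mul_zero]

/-- Interval sums when some coefficient is minor. -/
theorem PolynomiallyRegular.exists_bound_coeff {A : Set ℤ} (hA : PolynomiallyRegular A) (d : ℕ) :
    ∀ a a₁ : ℕ, ∃ (B : ℕ) (T : ℝ), ∀ N : ℕ, T ≤ Real.log N →
      ∀ Q : ℕ, 1 ≤ Q → (Q : ℝ) ≤ Real.log N ^ a₁ →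
      ∀ P : Polynomial ℝ, P.natDegree ≤ d → ∀ i, 1 ≤ i → i ≤ d →
        ¬ IsMajor (Real.log N ^ B) ((N : ℝ) ^ i) (P.coeff i) →
      ∀ (r u v : ℤ), -(N : ℤ) ≤ u → v ≤ N →
        ‖∑ n ∈ Finset.Icc u v, phaseTerm A Q r P n‖ ≤ N / Real.log N ^ a := by
  induction d with
  | zero => exact fun _ _ => ⟨0, 0, fun N _ Q _ _ P _ i h1 h2 => by omega⟩
  | succ d ih =>
    intro a a₁
    obtain ⟨B₁, T₁, h₁⟩ := hA.exists_bound_Icc (Nat.succ_le_succ (Nat.zero_le d)) a a₁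
    -- The saving demanded of lower degree covers a₁ + B₁ powers for the number of classes, B₁ for
    -- the variation of the slow factor, and d + 6 for the constant 22(d + 1).
    obtain ⟨B₂, T₂, h₂⟩ := ih (a + a₁ + 2 * B₁ + d + 6) (a₁ + B₁)
    obtain ⟨T', hT'⟩ := exists_log_pow_le 0
    refine ⟨B₁ + B₂, max (max T₁ T₂) T', fun N hN Q hQ hQl P hP i hi1 hi2 hmin r u v hu hv => ?_⟩
    have hl2 := (hT' N ((le_max_right _ _).trans hN)).1
    replace h₁ := h₁ N (((le_max_left _ _).trans (le_max_left _ _)).trans hN) Q hQ hQl P hP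
    replace h₂ := h₂ N (((le_max_right _ _).trans (le_max_left _ _)).trans hN)
    set l := Real.log N with hl
    have hl0 : 0 < l := by linarith
    have hl1 : 1 ≤ l := by linarith
    have pw : ∀ m n : ℕ, m ≤ n → l ^ m ≤ l ^ n := fun m n h => pow_le_pow_right₀ hl1 h
    have hN1 : 1 ≤ N := by
      rcases Nat.eq_zero_or_pos N with rfl | h
      · simp at hl; linarith
      · exact h
    have hN0 : (0 : ℝ) < N := by exact_mod_cast hN1
    have hmono : ∀ B, B ≤ B₁ + B₂ → ∀ (i : ℕ) (x : ℝ), IsMajor (l ^ B) ((N : ℝ) ^ i) x →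
        IsMajor (l ^ (B₁ + B₂)) ((N : ℝ) ^ i) x := by
      intro B hB i x h
      have := pw _ _ hB
      exact h.mono this (by gcongr)
    by_cases htop : IsMajor (l ^ B₁) ((N : ℝ) ^ (d + 1)) (P.coeff (d + 1))
    swap
    · exact h₁ htop r u v hu hv
    have hid : i ≠ d + 1 := by
      rintro rfl
      exact hmin (hmono _ (by omega) _ _ htop)
    -- The top coefficient is m/q + θ with |θ| ≤ l^B₁/N^(d+1), so the phase θ n^(d+1) has variation
    -- O(l^B₁) on [-N, N].
    obtain ⟨q, hq1, hq2, m, hm⟩ := htop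
    have hq0 : (1 : ℝ) ≤ q := by exact_mod_cast hq1
    set θ := P.coeff (d + 1) - m / q with hθ
    have hθle : |θ| ≤ l ^ B₁ / N ^ (d + 1) := by
      have h1 : q * P.coeff (d + 1) - m = q * θ := by rw [hθ]; field_simp
      rw [h1, abs_mul, Nat.abs_cast] at hm
      exact (le_mul_of_one_le_left (abs_nonneg _) hq0).trans hm
    have hdeg : (P.erase (d + 1)).natDegree ≤ d := by
      rw [Polynomial.natDegree_le_iff_coeff_eq_zero]
      intro m hm
      by_cases hmd : m = d + 1
      · rw [hmd, Polynomial.erase_same]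
      · rw [Polynomial.erase_ne _ hmd]
        exact Polynomial.coeff_eq_zero_of_natDegree_lt (by omega)
    have hQq : ((Q * q : ℕ) : ℝ) ≤ l ^ (a₁ + B₁) := by
      push_cast
      rw [pow_add]
      gcongr
    have hcl := h₂ (Q * q) (Nat.mul_pos hQ hq1) hQq (P.erase (d + 1)) hdeg i hi1 (by omega) (by
      rw [Polynomial.erase_ne _ hid]
      exact fun h => hmin (hmono _ (by omega) _ _ h))
    set E := (N : ℝ) / l ^ (a + a₁ + 2 * B₁ + d + 6) with hE
    have hE0 : 0 ≤ E := by positivity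
    rcases lt_or_ge v u with huv | huv
    · rw [Finset.Icc_eq_empty (by omega), Finset.sum_empty, norm_zero]
      positivity
    have hvar : ∑ n ∈ Finset.Ico u v,
        ‖addChar (θ * ((n + 1 : ℤ) : ℝ) ^ (d + 1)) - addChar (θ * (n : ℝ) ^ (d + 1))‖ ≤
        21 * (d + 1) * l ^ B₁ := by
      have hterm : ∀ n ∈ Finset.Ico u v,
          ‖addChar (θ * ((n + 1 : ℤ) : ℝ) ^ (d + 1)) - addChar (θ * (n : ℝ) ^ (d + 1))‖ ≤
          7 * (d + 1) * l ^ B₁ / N := by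
        intro n hn
        rw [Finset.mem_Ico] at hn
        have e1 : |(n : ℝ)| ≤ N := by
          rw [abs_le]
          exact ⟨by exact_mod_cast hu.trans hn.1, by exact_mod_cast (by omega : n ≤ N)⟩
        have e2 : |(n : ℝ) + 1| ≤ N := by
          rw [abs_le]
          exact ⟨by exact_mod_cast (by omega : -(N : ℤ) ≤ n + 1),
            by exact_mod_cast (by omega : n + 1 ≤ (N : ℤ))⟩
        refine (norm_addChar_sub_le _ _).trans ?_
        rw [← mul_sub, abs_mul]
        push_cast
        calc 7 * (|θ| * |((n : ℝ) + 1) ^ (d + 1) - n ^ (d + 1)|)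
            ≤ 7 * (l ^ B₁ / N ^ (d + 1) * ((d + 1) * N ^ d)) := by
              gcongr
              exact abs_pow_succ_sub_pow_le d e1 e2
          _ = _ := by rw [pow_succ]; field_simp
      refine (Finset.sum_le_card_nsmul _ _ _ hterm).trans ?_
      rw [nsmul_eq_mul]
      have hc : ((Finset.Ico u v).card : ℝ) ≤ 3 * N := by
        refine le_trans (Nat.cast_le.2 (Finset.card_le_card fun n hn => ?_)) (card_Icc_le N hN1)
        rw [Finset.mem_Ico] at hn
        exact Finset.mem_Icc.2 ⟨by omega, by omega⟩
      calc _ ≤ 3 * (N : ℝ) * (7 * (d + 1) * l ^ B₁ / N) := by gcongr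
        _ = _ := by field_simp; norm_num
    have hclass : ∀ t : ℤ, ‖∑ n ∈ Finset.Icc u v, phaseTerm A (Q * q) t P n‖ ≤
        E * (22 * (d + 1) * l ^ B₁) := by
      intro t
      simp_rw [phaseTerm_eq_mul_erase A hq1 t m P (d + 1)]
      rw [← Finset.mul_sum, norm_mul, norm_addChar, one_mul]
      refine (norm_sum_mul_le (M := E) (w := fun n : ℤ => addChar (θ * (n : ℝ) ^ (d + 1))) huv
        fun s hs => hcl t u s hu ((Finset.mem_Icc.1 hs).2.trans hv)).trans ?_
      gcongr
      rw [norm_addChar]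
      have : (1 : ℝ) ≤ l ^ B₁ := one_le_pow₀ hl1
      have : (0 : ℝ) ≤ d := by positivity
      nlinarith
    rw [sum_phaseTerm_split A hQ hq1 r P]
    refine (norm_sum_le_of_le (n := fun _ => E * (22 * (d + 1) * l ^ B₁)) _
      fun t _ => hclass t).trans ?_
    rw [Finset.sum_const, nsmul_eq_mul]
    have hcard : ((((Finset.Ico (0 : ℤ) (Q * q : ℕ)).filter (fun t => t ≡ r [ZMOD Q])).card : ℕ) :
        ℝ) ≤ l ^ (a₁ + B₁) := by
      refine le_trans (Nat.cast_le.2 (Finset.card_filter_le _ _)) ?_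
      rw [Int.card_Ico, sub_zero, Int.toNat_natCast]
      exact hQq
    calc _ ≤ l ^ (a₁ + B₁) * (E * (22 * (d + 1) * l ^ B₁)) := by gcongr
      _ = (22 * (d + 1) * l ^ (a₁ + 2 * B₁)) * E := by ring
      _ ≤ l ^ (a₁ + 2 * B₁ + d + 6) * E := by
        gcongr
        refine const_mul_pow_le hl2 (d + 6) _ _ ?_ (by omega)
        have h1 : ((d + 1 : ℕ) : ℝ) ≤ 2 ^ (d + 1) := by
          exact_mod_cast (Nat.lt_two_pow_self (n := d + 1)).le
        push_cast at h1
        calc 22 * ((d : ℝ) + 1) ≤ 2 ^ 5 * 2 ^ (d + 1) := by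
              norm_num at h1 ⊢; linarith
          _ = _ := by rw [← pow_add]; congr 1; ring
      _ = N / l ^ a := by
        rw [hE]
        have : l ^ (a + a₁ + 2 * B₁ + d + 6) = l ^ (a₁ + 2 * B₁ + d + 6) * l ^ a := by
          rw [← pow_add]; congr 1; ring
        rw [this]
        field_simp

/-! ### Slicing the box along the first variable -/

theorem sum_intBox_succ {M : Type*} [AddCommMonoid M] (k N : ℕ) (F : (Fin (k + 1) → ℤ) → M) :
    ∑ n ∈ intBox (k + 1) N, F n =
      ∑ s ∈ intBox k N, ∑ t ∈ Finset.Icc (-(N : ℤ)) N, F (Fin.cons t s) := by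
  rw [← Finset.sum_product']
  refine Finset.sum_nbij' (fun n => (Fin.tail n, n 0))
    (fun p => (Fin.cons p.2 p.1 : Fin (k + 1) → ℤ)) ?_ ?_ ?_ ?_ ?_
  · intro n hn
    rw [mem_intBox] at hn
    exact Finset.mem_product.2 ⟨mem_intBox.2 fun i => hn i.succ, hn 0⟩
  · intro p hp
    rw [Finset.mem_product, mem_intBox] at hp
    refine mem_intBox.2 fun i => Fin.cases ?_ (fun i => ?_) i
    · exact hp.2
    · exact hp.1 i
  · intro n _
    exact Fin.cons_self_tail n
  · intro p _
    rfl
  · intro n _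
    exact congrArg F (Fin.cons_self_tail n).symm

theorem phaseTerm_slice {A : Set ℤ} {k : ℕ} (P : MvPolynomial (Fin (k + 1)) ℝ) (t : ℤ)
    (s : Fin k → ℤ) :
    Set.indicator {m : Fin (k + 1) → ℤ | m 0 ∈ A}
      (fun m => addChar (MvPolynomial.eval (fun i => (m i : ℝ)) P)) (Fin.cons t s) =
    phaseTerm A 1 0 ((MvPolynomial.finSuccEquiv ℝ k P).map
      (MvPolynomial.eval (fun i => (s i : ℝ)))) t := by
  by_cases h : t ∈ A
  · have h' : (Fin.cons t s : Fin (k + 1) → ℤ) ∈ {m : Fin (k + 1) → ℤ | m 0 ∈ A} := h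
    rw [phaseTerm_of_mem ⟨h, by simp [Int.modEq_one]⟩, Set.indicator_of_mem h', eval_int_cons]
    simp
  · have h' : (Fin.cons t s : Fin (k + 1) → ℤ) ∉ {m : Fin (k + 1) → ℤ | m 0 ∈ A} := h
    rw [phaseTerm_of_notMem (fun h1 => h h1.1), Set.indicator_of_notMem h']

/-- The multidimensional bound when the minor coefficient involves the first variable. The weight
enters only through its variation along the first axis. -/
theorem PolynomiallyRegular.exists_bound_box {A : Set ℤ} (hA : PolynomiallyRegular A)
    (k d a : ℕ) : ∃ (B : ℕ) (T : ℝ), ∀ N : ℕ, T ≤ Real.log N →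
      ∀ P : MvPolynomial (Fin (k + 1)) ℝ, P.totalDegree ≤ d → ∀ γ : Fin (k + 1) →₀ ℕ, 1 ≤ γ 0 →
        γ.degree ≤ d → ¬ IsMajor (Real.log N ^ B) ((N : ℝ) ^ γ.degree) (P.coeff γ) →
      ∀ (w : (Fin (k + 1) → ℤ) → ℂ) (V : ℝ), 0 ≤ V →
        (∀ (s : Fin k → ℤ) (f : ℤ → ℂ) (M : ℝ),
          (∀ u v : ℤ, -(N : ℤ) ≤ u → v ≤ N → ‖∑ n ∈ Finset.Icc u v, f n‖ ≤ M) →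
          ‖∑ t ∈ Finset.Icc (-(N : ℤ)) N, f t * w (Fin.cons t s)‖ ≤ M * V) →
        ‖∑ n ∈ intBox (k + 1) N, Set.indicator {m : Fin (k + 1) → ℤ | m 0 ∈ A}
          (fun m => addChar (MvPolynomial.eval (fun i => (m i : ℝ)) P)) n * w n‖ ≤
          V * N ^ (k + 1) / Real.log N ^ a := by
  classical
  obtain ⟨B₁, T₁, h₁⟩ := hA.exists_bound_coeff d (a + 2 * k + 1) 0
  obtain ⟨C, hC⟩ := exists_isMajor_mvCoeff k d
  obtain ⟨D, hD⟩ : ∃ D, D = B₁ + a + 3 := ⟨_, rfl⟩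
  obtain ⟨T', hT'⟩ := exists_log_pow_le (D * C)
  refine ⟨D * C, max T₁ T', fun N hN P hP γ hγ0 hγd hmin w V hV hw => ?_⟩
  obtain ⟨hl2, hlN⟩ := hT' N ((le_max_right _ _).trans hN)
  replace h₁ := h₁ N ((le_max_left _ _).trans hN) 1 le_rfl (by simp)
  set l := Real.log N with hl
  have hl0 : 0 < l := by linarith
  have hl1 : 1 ≤ l := by linarith
  have pw : ∀ m n : ℕ, m ≤ n → l ^ m ≤ l ^ n := fun m n h => pow_le_pow_right₀ hl1 h
  have hN0 : (0 : ℝ) < N := lt_of_lt_of_le (by positivity) hlN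
  have hN1 : 1 ≤ N := by exact_mod_cast hN0
  have hN1' : (1 : ℝ) ≤ N := by exact_mod_cast hN1
  set i := γ 0 with hi
  have hdeg : γ.degree = i + γ.tail.degree := by
    rw [Finsupp.degree_eq_sum, Finsupp.degree_eq_sum, Fin.sum_univ_succ]
    rfl
  set c := (MvPolynomial.finSuccEquiv ℝ k P).coeff i with hc
  have hco : P.coeff γ = c.coeff γ.tail := by
    rw [hc, MvPolynomial.finSuccEquiv_coeff_coeff, hi, Finsupp.cons_tail]
  set G := (intBox k N).filter (fun s =>
    IsMajor (l ^ B₁) ((N : ℝ) ^ i) (MvPolynomial.eval (fun j => (s j : ℝ)) c)) with hG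
  -- More slices than this with a major coefficient would make every coefficient of `c` major,
  -- including that of γ. The scale N^i dominates N because i ≥ 1.
  have hGc : (G.card : ℝ) ≤ (N : ℝ) ^ k / l ^ D := by
    by_contra hlt
    refine hmin ?_
    have h := hC (l ^ D) ((N : ℝ) ^ i) N c G ?_ ?_ ?_ (Finset.filter_subset _ _)
      (not_le.1 hlt).le ?_ ?_ γ.tail
    · rwa [← pow_mul, ← pow_add, ← hdeg, ← hco] at h
    · calc (2 : ℝ) ≤ l ^ 1 := by simpa using hl2
        _ ≤ _ := pw 1 _ (by omega)
    · rwa [← pow_mul]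
    · simpa using pow_le_pow_right₀ hN1' hγ0
    · by_cases hz : c = 0
      · rw [hz]; simp
      · have := MvPolynomial.totalDegree_coeff_finSuccEquiv_add_le P i hz
        rw [← hc] at this
        omega
    · intro s hs
      have := pw B₁ D (by omega)
      exact (Finset.mem_filter.1 hs).2.mono this (by gcongr)
  have hPd : (MvPolynomial.finSuccEquiv ℝ k P).natDegree ≤ d := by
    rw [MvPolynomial.natDegree_finSuccEquiv]
    exact (MvPolynomial.degreeOf_le_totalDegree P 0).trans hP
  have hid : i ≤ d := by omega
  rw [sum_intBox_succ]
  simp_rw [phaseTerm_slice]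
  rw [← Finset.sum_filter_add_sum_filter_not (intBox k N) (fun s =>
    IsMajor (l ^ B₁) ((N : ℝ) ^ i) (MvPolynomial.eval (fun j => (s j : ℝ)) c))]
  have hbad : ‖∑ s ∈ G, ∑ t ∈ Finset.Icc (-(N : ℤ)) N, phaseTerm A 1 0
      ((MvPolynomial.finSuccEquiv ℝ k P).map (MvPolynomial.eval (fun i => (s i : ℝ)))) t *
        w (Fin.cons t s)‖ ≤ V * N ^ (k + 1) / l ^ (a + 1) := by
    refine (norm_sum_le_of_le (n := fun _ => 3 * N * V) _ fun s _ => hw s _ _ ?_).trans ?_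
    · intro u v hu hv
      refine (norm_sum_le_of_le (n := fun _ => (1 : ℝ)) _
        fun n _ => norm_phaseTerm_le _ _ _ _ _).trans ?_
      rw [Finset.sum_const, nsmul_eq_mul, mul_one]
      exact (Nat.cast_le.2 (Finset.card_le_card (Finset.Icc_subset_Icc hu hv))).trans
        (card_Icc_le N hN1)
    · rw [Finset.sum_const, nsmul_eq_mul]
      calc _ ≤ (N : ℝ) ^ k / l ^ D * (3 * N * V) := by gcongr
        _ = V * N ^ (k + 1) * (3 / l ^ D) := by ring
        _ ≤ V * N ^ (k + 1) * (1 / l ^ (a + 1)) := by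
          refine mul_le_mul_of_nonneg_left ?_ (by positivity)
          rw [div_le_div_iff₀ (by positivity) (by positivity), one_mul]
          exact const_mul_pow_le hl2 2 _ _ (by norm_num) (by omega)
        _ = _ := by ring
  have hgood : ‖∑ s ∈ (intBox k N).filter (fun s =>
      ¬ IsMajor (l ^ B₁) ((N : ℝ) ^ i) (MvPolynomial.eval (fun j => (s j : ℝ)) c)),
      ∑ t ∈ Finset.Icc (-(N : ℤ)) N, phaseTerm A 1 0
      ((MvPolynomial.finSuccEquiv ℝ k P).map (MvPolynomial.eval (fun i => (s i : ℝ)))) t *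
        w (Fin.cons t s)‖ ≤ V * N ^ (k + 1) / l ^ (a + 1) := by
    refine (norm_sum_le_of_le (n := fun _ => N / l ^ (a + 2 * k + 1) * V) _
      fun s hs => hw s _ _ ?_).trans ?_
    · intro u v hu hv
      refine h₁ _ (Polynomial.natDegree_map_le.trans hPd) i hγ0 hid ?_ 0 u v hu hv
      rw [Polynomial.coeff_map]
      exact (Finset.mem_filter.1 hs).2
    · rw [Finset.sum_const, nsmul_eq_mul]
      calc _ ≤ (3 * N : ℝ) ^ k * (N / l ^ (a + 2 * k + 1) * V) := by
            gcongr
            exact (Nat.cast_le.2 (Finset.card_filter_le _ _)).trans (card_intBox_le k hN1)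
        _ = V * N ^ (k + 1) * (3 ^ k / l ^ (a + 2 * k + 1)) := by rw [mul_pow]; ring
        _ ≤ V * N ^ (k + 1) * (1 / l ^ (a + 1)) := by
          refine mul_le_mul_of_nonneg_left ?_ (by positivity)
          rw [div_le_div_iff₀ (by positivity) (by positivity), one_mul]
          refine const_mul_pow_le hl2 (2 * k) _ _ ?_ (by omega)
          rw [pow_mul]
          gcongr
          norm_num
        _ = _ := by ring
  refine (norm_add_le _ _).trans ((add_le_add hbad hgood).trans ?_)
  rw [← add_div, div_le_div_iff₀ (by positivity) (by positivity)]
  calc (V * (N : ℝ) ^ (k + 1) + V * N ^ (k + 1)) * l ^ a = V * N ^ (k + 1) * (2 * l ^ a) := by ring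
    _ ≤ _ := by
      gcongr
      exact const_mul_pow_le hl2 1 _ _ (by norm_num) (by omega)

/-- A coefficient with a rational approximation of medium denominator is minor. -/
theorem not_isMajor_of_approx {l X x : ℝ} {a q B : ℕ} (hl : 2 ≤ l) (hX : 0 < X)
    (hcop : Nat.Coprime a q) (hx : |x - (a : ℝ) / q| ≤ 1 / (q : ℝ) ^ 2)
    (hq1 : l ^ (B + 2) ≤ (q : ℝ)) (hq2 : (q : ℝ) ≤ X / l ^ (B + 2)) :
    ¬ IsMajor (l ^ B) X x := by
  rintro ⟨p, hp1, hp2, m, hm⟩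
  have hl0 : 0 < l := by linarith
  have hq0 : (0 : ℝ) < q := lt_of_lt_of_le (by positivity) hq1
  have hp0 : (0 : ℝ) < p := by exact_mod_cast hp1
  have hpow : 4 * l ^ B ≤ l ^ (B + 2) := const_mul_pow_le hl 2 _ _ (by norm_num) (by omega)
  -- An integer of size at most 1/2 vanishes, so q divides pa, hence p. This contradicts p ≤ l^B <
  -- q.
  have h1 : |(p * a - m * q : ℝ)| ≤ 1 / 2 := by
    have h2 : (p * a - m * q : ℝ) = q * (p * x - m) - q * p * (x - a / q) := by
      field_simp; ring
    rw [h2]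
    refine (abs_sub _ _).trans ?_
    rw [abs_mul, abs_mul, abs_mul, Nat.abs_cast, Nat.abs_cast]
    have e1 : (q : ℝ) * |p * x - m| ≤ 1 / 4 := by
      calc (q : ℝ) * |p * x - m| ≤ X / l ^ (B + 2) * (l ^ B / X) := by gcongr
        _ = l ^ B / l ^ (B + 2) := by field_simp
        _ ≤ 1 / 4 := by
          rw [div_le_div_iff₀ (by positivity) (by norm_num)]; linarith
    have e2 : (q : ℝ) * p * |x - a / q| ≤ 1 / 4 := by
      calc (q : ℝ) * p * |x - a / q| ≤ q * l ^ B * (1 / (q : ℝ) ^ 2) := by gcongr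
        _ = l ^ B / q := by field_simp
        _ ≤ l ^ B / l ^ (B + 2) := by gcongr
        _ ≤ 1 / 4 := by
          rw [div_le_div_iff₀ (by positivity) (by norm_num)]; linarith
    linarith
  have h3 : (p * a - m * q : ℤ) = 0 := by
    have : |((p * a - m * q : ℤ) : ℝ)| < 1 := by push_cast; linarith
    exact Int.abs_lt_one_iff.1 (by exact_mod_cast this)
  have h4 : (q : ℤ) ∣ p * a := ⟨m, by linarith⟩
  have h5 : q ∣ p * a := by exact_mod_cast h4
  have h6 : q ≤ p := Nat.le_of_dvd hp1 (hcop.symm.dvd_of_dvd_mul_right h5)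
  have h7 : (q : ℝ) ≤ p := by exact_mod_cast h6
  have h8 : 0 < l ^ B := by positivity
  linarith

/-! ### Variation of the weight along an axis -/

theorem sum_inv_le_log {N : ℕ} {u v : ℤ} (hu : -(N : ℤ) ≤ u) (hv : v ≤ N) :
    ∑ n ∈ Finset.Ico u v, (if 0 ≤ n then ((n : ℝ) + 1)⁻¹ else (-(n : ℝ))⁻¹) ≤
      2 * (1 + Real.log N) := by
  set g : ℤ → ℝ := fun n => if 0 ≤ n then ((n : ℝ) + 1)⁻¹ else (-(n : ℝ))⁻¹ with hg
  have hg0 : ∀ n, 0 ≤ g n := by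
    intro n
    simp only [hg]
    split_ifs with h
    · have : (0 : ℝ) ≤ n := by exact_mod_cast h
      positivity
    · have : (n : ℝ) < 0 := by exact_mod_cast not_le.1 h
      exact inv_nonneg.2 (by linarith)
  have hharm : ∑ j ∈ Finset.range N, ((j : ℝ) + 1)⁻¹ ≤ 1 + Real.log N := by
    have := harmonic_le_one_add_log N
    rw [harmonic] at this
    push_cast at this
    exact this
  have hsub : Finset.Ico u v ⊆
      Finset.Ico (-(N : ℤ)) (-(N : ℤ) + N) ∪ Finset.Ico (0 : ℤ) (0 + N) := by
    intro n hn
    simp only [Finset.mem_Ico, Finset.mem_union] at hn ⊢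
    omega
  refine (Finset.sum_le_sum_of_subset_of_nonneg hsub fun n _ _ => hg0 n).trans ?_
  rw [Finset.sum_union (by
    rw [Finset.disjoint_left]
    intro n hn hn'
    simp only [Finset.mem_Ico] at hn hn'
    omega), sum_Ico_int_eq_sum_range, sum_Ico_int_eq_sum_range, two_mul]
  refine add_le_add ?_ ?_
  · rw [← Finset.sum_range_reflect]
    refine le_trans (le_of_eq (Finset.sum_congr rfl fun j hj => ?_)) hharm
    have hj' := Finset.mem_range.1 hj
    simp only [hg]
    rw [if_neg (by omega)]
    have : ((N - 1 - j : ℕ) : ℝ) = N - 1 - j := by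
      rw [Nat.sub_sub, Nat.cast_sub (by omega)]; push_cast; ring
    push_cast
    rw [this]
    congr 1
    ring
  · refine le_trans (le_of_eq (Finset.sum_congr rfl fun j _ => ?_)) hharm
    simp only [hg]
    rw [if_pos (by omega)]
    push_cast
    rw [zero_add]

theorem latticePoint_update {k : ℕ} (m : Fin k → ℤ) (j : Fin k) (t : ℤ) :
    latticePoint (Function.update m j t) =
      latticePoint (Function.update m j 0) + (t : ℝ) • EuclideanSpace.single j (1 : ℝ) := by
  ext i
  by_cases h : i = j
  · subst h; simp [latticePoint]
  · simp [latticePoint, h]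

/-- On the segment between the two points the j-th coordinate is n + θ with 0 ≤ θ ≤ 1, so the norm
is at least |n + θ|. The mean value inequality then gives a bound independent of the other
coordinates. -/
theorem norm_sub_le_of_fderiv_le {k : ℕ} {φ : EuclideanSpace ℝ (Fin k) → ℂ}
    (hφ : Differentiable ℝ φ) (hφ' : ∀ x, ‖fderiv ℝ φ x‖ ≤ (1 + ‖x‖)⁻¹)
    (m : Fin k → ℤ) (j : Fin k) (n : ℤ) :
    ‖φ (latticePoint (Function.update m j (n + 1))) - φ (latticePoint (Function.update m j n))‖ ≤
      if 0 ≤ n then ((n : ℝ) + 1)⁻¹ else (-(n : ℝ))⁻¹ := by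
  set y := latticePoint (Function.update m j n) with hy
  set e : EuclideanSpace ℝ (Fin k) := EuclideanSpace.single j (1 : ℝ) with he
  have hy1 : latticePoint (Function.update m j (n + 1)) = y + e := by
    rw [hy, latticePoint_update, latticePoint_update m j n, ← he]
    push_cast
    module
  rw [hy1]
  have hb : ∀ z ∈ segment ℝ y (y + e), ‖fderiv ℝ φ z‖ ≤
      if 0 ≤ n then ((n : ℝ) + 1)⁻¹ else (-(n : ℝ))⁻¹ := by
    intro z hz
    rw [segment_eq_image'] at hz
    obtain ⟨θ, ⟨hθ0, hθ1⟩, rfl⟩ := hz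
    refine (hφ' _).trans ?_
    have h1 : |(n : ℝ) + θ| ≤ ‖y + θ • (y + e - y)‖ := by
      have := PiLp.norm_apply_le (y + θ • (y + e - y)) j
      have h2 : (y + θ • (y + e - y)) j = n + θ := by
        simp [hy, he, latticePoint]
      rwa [h2, Real.norm_eq_abs] at this
    split_ifs with h
    · have h0 : (0 : ℝ) ≤ n := by exact_mod_cast h
      refine inv_anti₀ (by positivity) ?_
      have := le_abs_self ((n : ℝ) + θ)
      linarith
    · have h0 : (n : ℝ) ≤ -1 := by
        have : n ≤ -1 := by omega
        exact_mod_cast this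
      refine inv_anti₀ (by linarith) ?_
      have := neg_le_abs ((n : ℝ) + θ)
      linarith
  have := (convex_segment y (y + e)).norm_image_sub_le_of_norm_fderiv_le
    (fun z _ => hφ z) hb (left_mem_segment ℝ _ _) (right_mem_segment ℝ _ _)
  rw [add_sub_cancel_left, he, PiLp.norm_single, norm_one, mul_one] at this
  exact this

/-- The variation of `1_Ω φ` along a coordinate axis. -/
theorem norm_sum_mul_weight_le {k : ℕ} {φ : EuclideanSpace ℝ (Fin k) → ℂ} {K : ℝ}
    (hφ : Differentiable ℝ φ) (hK : ∀ x, ‖φ x‖ ≤ K)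
    (hφ' : ∀ x, ‖fderiv ℝ φ x‖ ≤ (1 + ‖x‖)⁻¹) {Ω : Set (EuclideanSpace ℝ (Fin k))}
    (hΩ : Convex ℝ Ω) (p : (Fin k → ℤ) → Prop) (m : Fin k → ℤ) (j : Fin k)
    (hp : ∀ t, p (Function.update m j t) ↔ p m) {N : ℕ} {f : ℤ → ℂ} {M : ℝ}
    (hM : ∀ u v : ℤ, -(N : ℤ) ≤ u → v ≤ N → ‖∑ n ∈ Finset.Icc u v, f n‖ ≤ M) :
    ‖∑ t ∈ Finset.Icc (-(N : ℤ)) N, f t * Set.indicator {m : Fin k → ℤ | p m ∧ latticePoint m ∈ Ω}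
      (fun m => φ (latticePoint m)) (Function.update m j t)‖ ≤
      M * (K + 2 * (1 + Real.log N)) := by
  classical
  -- The interval from 1 to 0 is empty, so its sum is 0.
  have hM0 : 0 ≤ M := (norm_nonneg _).trans (hM 1 0 (by omega) (by omega))
  have hK0 : 0 ≤ K := (norm_nonneg _).trans (hK 0)
  have hV0 : 0 ≤ M * (K + 2 * (1 + Real.log N)) := by
    have := Real.log_natCast_nonneg N
    positivity
  set S := (Finset.Icc (-(N : ℤ)) N).filter (fun t => Function.update m j t ∈
    {m : Fin k → ℤ | p m ∧ latticePoint m ∈ Ω}) with hS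
  have hsum : ∑ t ∈ Finset.Icc (-(N : ℤ)) N, f t * Set.indicator
      {m : Fin k → ℤ | p m ∧ latticePoint m ∈ Ω}
      (fun m => φ (latticePoint m)) (Function.update m j t) =
      ∑ t ∈ S, f t * φ (latticePoint (Function.update m j t)) := by
    rw [hS, Finset.sum_filter]
    refine Finset.sum_congr rfl fun t _ => ?_
    split_ifs with h
    · rw [Set.indicator_of_mem h]
    · rw [Set.indicator_of_notMem h, mul_zero]
  rw [hsum]
  rcases S.eq_empty_or_nonempty with h | hne
  · rw [h, Finset.sum_empty, norm_zero]
    exact hV0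
  set u := S.min' hne with hu
  set v := S.max' hne with hv
  have hmu := Finset.mem_filter.1 (S.min'_mem hne)
  have hmv := Finset.mem_filter.1 (S.max'_mem hne)
  rw [← hu] at hmu
  rw [← hv] at hmv
  have hpm : p m := (hp u).1 hmu.2.1
  set y := latticePoint (Function.update m j 0) with hy
  set e : EuclideanSpace ℝ (Fin k) := EuclideanSpace.single j (1 : ℝ) with he
  have hconv : Convex ℝ ((fun x : ℝ => y + x • e) ⁻¹' Ω) := by
    intro x hx x' hx' a b ha hb hab
    have := hΩ hx hx' ha hb hab
    have heq : a • (y + x • e) + b • (y + x' • e) = y + (a • x + b • x') • e := by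
      rw [smul_add, smul_add, add_add_add_comm, ← add_smul, hab, one_smul, smul_smul, smul_smul,
        ← add_smul, smul_eq_mul, smul_eq_mul]
    simp only [Set.mem_preimage]
    rw [← heq]
    exact this
  -- Convexity of Ω enters here: along the line the cutoff is the indicator of an interval, so it
  -- only moves the endpoints of the sum.
  have hSI : S = Finset.Icc u v := by
    refine Finset.Subset.antisymm
      (fun t ht => Finset.mem_Icc.2 ⟨S.min'_le t ht, S.le_max' t ht⟩) fun t ht => ?_
    rw [Finset.mem_Icc] at ht
    have h1 := Finset.mem_Icc.1 hmu.1
    have h2 := Finset.mem_Icc.1 hmv.1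
    refine Finset.mem_filter.2 ⟨Finset.mem_Icc.2 ⟨by omega, by omega⟩, (hp t).2 hpm, ?_⟩
    have hu' := hmu.2.2
    have hv' := hmv.2.2
    rw [latticePoint_update] at hu' hv' ⊢
    exact hconv.ordConnected.out hu' hv' ⟨by exact_mod_cast ht.1, by exact_mod_cast ht.2⟩
  have hlu := (Finset.mem_Icc.1 hmu.1).1
  have hlv := (Finset.mem_Icc.1 hmv.1).2
  have huv : u ≤ v := Finset.min'_le _ _ (S.max'_mem hne)
  rw [hSI]
  refine (norm_sum_mul_le (w := fun t => φ (latticePoint (Function.update m j t))) huv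
    fun t ht => hM u t hlu ((Finset.mem_Icc.1 ht).2.trans hlv)).trans ?_
  gcongr
  · exact hK _
  · exact (Finset.sum_le_sum fun n _ => norm_sub_le_of_fderiv_le hφ hφ' m j n).trans
      (sum_inv_le_log hlu hlv)

/-! ### Moving the chosen variable to the front, and conclusion -/

theorem sum_intBox_comp_perm {M : Type*} [AddCommMonoid M] {k N : ℕ} (σ : Equiv.Perm (Fin k))
    (F : (Fin k → ℤ) → M) : ∑ n ∈ intBox k N, F n = ∑ n ∈ intBox k N, F (n ∘ σ) := by
  refine (Finset.sum_equiv (Equiv.arrowCongr σ (Equiv.refl ℤ)).symm ?_ ?_).symm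
  · intro n
    rw [mem_intBox, mem_intBox]
    exact ⟨fun h i => h (σ i), fun h i => by simpa using h (σ.symm i)⟩
  · intro n _
    rfl

theorem cons_comp_swap {k : ℕ} (j : Fin (k + 1)) (s : Fin k → ℤ) (t : ℤ) :
    (Fin.cons t s : Fin (k + 1) → ℤ) ∘ Equiv.swap 0 j =
      Function.update ((Fin.cons 0 s : Fin (k + 1) → ℤ) ∘ Equiv.swap 0 j) j t := by
  funext i
  by_cases h : i = j
  · subst h; simp
  · rw [Function.update_of_ne h]
    have h0 : Equiv.swap 0 j i ≠ 0 := by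
      intro h0
      rw [Equiv.swap_apply_eq_iff, Equiv.swap_apply_left] at h0
      exact h h0
    obtain ⟨l, hl⟩ := Fin.exists_succ_eq.2 h0
    simp [← hl]

theorem norm_weightedExpSum_le {k : ℕ} (A : Fin k → Set ℤ) (P : MvPolynomial (Fin k) ℝ)
    (Ω : Set (EuclideanSpace ℝ (Fin k))) {φ : EuclideanSpace ℝ (Fin k) → ℂ} {K : ℝ}
    (hK : ∀ x, ‖φ x‖ ≤ K) {N : ℕ} (hN : 1 ≤ N) :
    ‖weightedExpSum A P Ω φ N‖ ≤ (3 * N) ^ k * K := by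
  have hK0 : 0 ≤ K := (norm_nonneg _).trans (hK 0)
  refine (norm_sum_le_of_le (n := fun _ => K) _ fun n _ => ?_).trans ?_
  · rw [norm_indicator_eq_indicator_norm]
    refine Set.indicator_le' (fun m _ => ?_) (fun _ _ => hK0) n
    rw [norm_mul, norm_addChar, one_mul]
    exact hK _
  · rw [Finset.sum_const, nsmul_eq_mul]
    gcongr
    exact card_intBox_le k hN

/-- The bound when the minor coefficient involves the variable `j`. -/
theorem exists_bound_weightedExpSum {k : ℕ} {A : Fin (k + 1) → Set ℤ} {j : Fin (k + 1)}
    (hA : PolynomiallyRegular (A j)) (d a : ℕ) :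
    ∃ (B : ℕ) (T : ℝ), ∀ N : ℕ, T ≤ Real.log N →
      ∀ P : MvPolynomial (Fin (k + 1)) ℝ, P.totalDegree ≤ d → ∀ γ : Fin (k + 1) →₀ ℕ, 1 ≤ γ j →
        γ.degree ≤ d → ¬ IsMajor (Real.log N ^ B) ((N : ℝ) ^ γ.degree) (P.coeff γ) →
      ∀ (φ : EuclideanSpace ℝ (Fin (k + 1)) → ℂ) (K : ℝ), Differentiable ℝ φ →
        (∀ x, ‖φ x‖ ≤ K) → (∀ x, ‖fderiv ℝ φ x‖ ≤ (1 + ‖x‖)⁻¹) →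
      ∀ Ω : Set (EuclideanSpace ℝ (Fin (k + 1))), Convex ℝ Ω →
        ‖weightedExpSum A P Ω φ N‖ ≤
          (K + 2 * (1 + Real.log N)) * N ^ (k + 1) / Real.log N ^ a := by
  obtain ⟨B, T, h⟩ := hA.exists_bound_box k d a
  refine ⟨B, T, fun N hN P hP γ hγ hγd hmin φ K hφ hK hφ' Ω hΩ => ?_⟩
  have hK0 : 0 ≤ K := (norm_nonneg _).trans (hK 0)
  set σ : Equiv.Perm (Fin (k + 1)) := Equiv.swap 0 j with hσ
  -- Membership in the other sets is constant along the j-th axis, so it joins the weight without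
  -- adding variation.
  set p : (Fin (k + 1) → ℤ) → Prop := fun m => ∀ i, i ≠ j → m i ∈ A i with hp
  set W : (Fin (k + 1) → ℤ) → ℂ := Set.indicator {m | p m ∧ latticePoint m ∈ Ω}
    (fun m => φ (latticePoint m)) with hW
  have hinj : Function.Injective (Finsupp.mapDomain σ : (Fin (k + 1) →₀ ℕ) → _) :=
    Finsupp.mapDomain_injective σ.injective
  have hdeg : (Finsupp.mapDomain σ γ).degree = γ.degree := Finsupp.degree_mapDomain _ _
  have key := h N hN (MvPolynomial.rename σ P) ((MvPolynomial.totalDegree_rename_le _ _).trans hP)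
    (Finsupp.mapDomain σ γ) ?_ (by rwa [hdeg]) ?_ (fun n => W (n ∘ σ))
    (K + 2 * (1 + Real.log N)) ?_ ?_
  · refine le_of_eq_of_le ?_ key
    congr 1
    rw [weightedExpSum, ← intBox, sum_intBox_comp_perm σ]
    refine Finset.sum_congr rfl fun n _ => ?_
    have hj : n (σ j) = n 0 := by rw [hσ, Equiv.swap_apply_right]
    have hev : MvPolynomial.eval (fun i => (((n ∘ σ) i : ℤ) : ℝ)) P =
        MvPolynomial.eval (fun i => (n i : ℝ)) (MvPolynomial.rename σ P) := by
      rw [MvPolynomial.eval_rename]; rfl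
    by_cases h0 : n 0 ∈ A j
    · rw [Set.indicator_of_mem (s := {m : Fin (k + 1) → ℤ | m 0 ∈ A j}) h0, hW]
      by_cases h1 : p (n ∘ σ) ∧ latticePoint (n ∘ σ) ∈ Ω
      · rw [Set.indicator_of_mem (s := {m | p m ∧ latticePoint m ∈ Ω}) h1,
          Set.indicator_of_mem, hev]
        refine ⟨fun i => ?_, h1.2⟩
        by_cases hij : i = j
        · subst hij
          rwa [Function.comp_apply, hj]
        · exact h1.1 i hij
      · rw [Set.indicator_of_notMem (s := {m | p m ∧ latticePoint m ∈ Ω}) h1, mul_zero,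
          Set.indicator_of_notMem]
        exact fun h2 => h1 ⟨fun i _ => h2.1 i, h2.2⟩
    · rw [Set.indicator_of_notMem (s := {m : Fin (k + 1) → ℤ | m 0 ∈ A j}) h0, zero_mul,
        Set.indicator_of_notMem]
      intro h2
      have := h2.1 j
      rw [Function.comp_apply, hj] at this
      exact h0 this
  · have : (0 : Fin (k + 1)) = σ j := by rw [hσ, Equiv.swap_apply_right]
    rwa [this, Finsupp.mapDomain_apply σ.injective]
  · rwa [hdeg, MvPolynomial.coeff_rename_mapDomain _ σ.injective]
  · have := Real.log_natCast_nonneg N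
    positivity
  · intro s f M hM
    rw [Finset.sum_congr rfl fun t _ => by rw [hσ, cons_comp_swap j s t]]
    refine norm_sum_mul_weight_le hφ hK hφ' hΩ p _ j (fun t => ?_) hM
    refine forall₂_congr fun i hi => ?_
    rw [Function.update_of_ne hi]

theorem mainTheorem8 (k : ℕ) (A : Fin k → Set ℤ) (hA : ∀ i, PolynomiallyRegular (A i))
    (d : ℕ) (α : ℝ) (hα : 0 < α) :
    ∃ β₀ : ℝ, 0 < β₀ ∧ ∀ K : ℝ, ∃ C : ℝ, 0 < C ∧
      ∀ φ : EuclideanSpace ℝ (Fin k) → ℂ, Differentiable ℝ φ →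
        (∀ x, ‖φ x‖ ≤ K) → (∀ x, ‖fderiv ℝ φ x‖ ≤ (1 + ‖x‖)⁻¹) →
      ∀ β : ℝ, β₀ < β →
      ∀ N : ℕ, 2 ≤ N →
      ∀ P : MvPolynomial (Fin k) ℝ, P.totalDegree ≤ d → P.coeff 0 = 0 →
      ∀ γ₀ : Fin k →₀ ℕ, 0 < γ₀.degree → γ₀.degree ≤ d →
      ∀ a q : ℕ, Nat.Coprime a q → 1 ≤ a → a ≤ q →
        |P.coeff γ₀ - (a : ℝ) / (q : ℝ)| ≤ 1 / (q : ℝ) ^ 2 →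
        Real.log N ^ β ≤ (q : ℝ) →
        (q : ℝ) ≤ (N : ℝ) ^ γ₀.degree * Real.log N ^ (-β) →
      ∀ Ω : Set (EuclideanSpace ℝ (Fin k)), Convex ℝ Ω →
        (∀ x ∈ Ω, ∀ i, |x i| ≤ (N : ℝ)) →
        ‖weightedExpSum A P Ω φ N‖ ≤ C * (N : ℝ) ^ k * Real.log N ^ (-α) := by
  rcases k with _ | k
  · refine ⟨1, one_pos, fun K => ⟨1, one_pos, fun φ _ _ _ β _ N _ P _ _ γ₀ hγ => ?_⟩⟩
    rw [Subsingleton.elim γ₀ 0, map_zero] at hγ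
    exact absurd hγ (lt_irrefl 0)
  -- The extra power of the logarithm pays for the variation K + 2(1 + log N) of the weight.
  choose B T h using fun j => exists_bound_weightedExpSum (A := A) (hA j) d (⌈α⌉₊ + 1)
  set D := ∑ j, B j with hD
  set T₀ := 2 + ∑ j, |T j| with hT₀
  have hT2 : 2 ≤ T₀ := by
    have : 0 ≤ ∑ j, |T j| := Finset.sum_nonneg fun _ _ => abs_nonneg _
    linarith
  -- D bounds the exponents for all variables, and the 2 is the loss in `not_isMajor_of_approx`. In
  -- the constant, |K| + 3 serves log N ≥ T₀, and the last term serves log N < T₀, where the trivial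
  -- bound suffices.
  refine ⟨(D + 2 : ℕ), by positivity, fun K =>
    ⟨|K| + 3 + 3 ^ (k + 1) * |K| * T₀ ^ α, by positivity,
    fun φ hφ hK hφ' β hβ N hN P hP _ γ₀ hγ0 hγd a q hcop _ _ hx hq1 hq2 Ω hΩ _ => ?_⟩⟩
  have hK0 : 0 ≤ K := (norm_nonneg _).trans (hK 0)
  rw [abs_of_nonneg hK0]
  have hN1 : (1 : ℝ) < N := by exact_mod_cast hN
  have hN0 : (0 : ℝ) < N := by linarith
  set l := Real.log N with hl
  have hl0 : 0 < l := Real.log_pos hN1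
  rcases lt_or_ge l T₀ with hlT | hlT
  · refine (norm_weightedExpSum_le A P Ω hK (by omega)).trans ?_
    have h1 : 1 ≤ T₀ ^ α * l ^ (-α) := by
      rw [Real.rpow_neg hl0.le, ← div_eq_mul_inv, one_le_div (by positivity)]
      exact Real.rpow_le_rpow hl0.le hlT.le hα.le
    calc (3 * (N : ℝ)) ^ (k + 1) * K = 3 ^ (k + 1) * K * N ^ (k + 1) * 1 := by
          rw [mul_pow]; ring
      _ ≤ 3 ^ (k + 1) * K * N ^ (k + 1) * (T₀ ^ α * l ^ (-α)) := by gcongr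
      _ = (3 ^ (k + 1) * K * T₀ ^ α) * N ^ (k + 1) * l ^ (-α) := by ring
      _ ≤ _ := by
        gcongr
        linarith
  · have hl2 : 2 ≤ l := hT2.trans hlT
    have hl1 : 1 ≤ l := by linarith
    obtain ⟨j, hj⟩ : ∃ j, 1 ≤ γ₀ j := by
      by_contra hne
      push Not at hne
      have : γ₀ = 0 := by
        ext j
        have := hne j
        simp only [Finsupp.coe_zero, Pi.zero_apply]
        omega
      rw [this, map_zero] at hγ0
      exact lt_irrefl 0 hγ0
    have hTj : T j ≤ l := by
      have h1 : |T j| ≤ ∑ j, |T j| :=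
        Finset.single_le_sum (f := fun j => |T j|) (fun _ _ => abs_nonneg _) (Finset.mem_univ j)
      have := le_abs_self (T j)
      linarith
    have hBj : B j ≤ D := Finset.single_le_sum (fun _ _ => Nat.zero_le _) (Finset.mem_univ j)
    have hlβ : l ^ (D + 2) ≤ l ^ β := by
      rw [← Real.rpow_natCast]
      exact Real.rpow_le_rpow_of_exponent_le hl1 hβ.le
    have hmin : ¬ IsMajor (l ^ D) ((N : ℝ) ^ γ₀.degree) (P.coeff γ₀) := by
      refine not_isMajor_of_approx hl2 (by positivity) hcop hx (hlβ.trans hq1) (hq2.trans ?_)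
      rw [Real.rpow_neg hl0.le, ← div_eq_mul_inv]
      gcongr
    have hminj : ¬ IsMajor (l ^ B j) ((N : ℝ) ^ γ₀.degree) (P.coeff γ₀) := by
      intro hmaj
      have := pow_le_pow_right₀ hl1 hBj
      exact hmin (hmaj.mono this (by gcongr))
    refine (h j N hTj P hP γ₀ hj hγd hminj φ K hφ hK hφ' Ω hΩ).trans ?_
    have h1 : K + 2 * (1 + l) ≤ (K + 3) * l := by nlinarith
    have h2 : (l ^ ⌈α⌉₊)⁻¹ ≤ l ^ (-α) := by
      rw [Real.rpow_neg hl0.le, ← Real.rpow_natCast]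
      refine inv_anti₀ (by positivity) (Real.rpow_le_rpow_of_exponent_le hl1 (Nat.le_ceil α))
    calc (K + 2 * (1 + l)) * N ^ (k + 1) / l ^ (⌈α⌉₊ + 1)
        ≤ (K + 3) * l * N ^ (k + 1) / l ^ (⌈α⌉₊ + 1) := by gcongr
      _ = (K + 3) * N ^ (k + 1) * (l ^ ⌈α⌉₊)⁻¹ := by rw [pow_succ l]; field_simp
      _ ≤ (K + 3) * N ^ (k + 1) * l ^ (-α) := by gcongr
      _ ≤ _ := by
        have : 0 ≤ 3 ^ (k + 1) * K * T₀ ^ α := by positivity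
        refine mul_le_mul_of_nonneg_right (mul_le_mul_of_nonneg_right ?_ ?_) ?_
        · linarith
        all_goals positivity
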